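/- **Theorem 4.4.** Let $n\in\mathbb N$ and let $\mathcal E$ be a complex Hilbert space. For a complex Hilbert space $\mathcal F$, let $H^2_{\mathcal F}(\mathbb D^n)$ be the Hilbert space of power series $f(\boldsymbol z)=\sum_{\boldsymbol k\in\mathbb N^n}a_{\boldsymbol k}\boldsymbol z^{\boldsymbol k}$ on the open unit polydisc $\mathbb D^n$ with $a_{\boldsymbol k}\in\mathcal F$ and $\|f\|^2=\sum_{\boldsymbol k}\|a_{\boldsymbol k}\|^2<\infty$, and let $H^\infty_{\mathcal B(\mathcal F,\mathcal E)}(\mathbb D^n)$ be the set of bounded analytic functions $\mathbb D^n\to\mathcal B(\mathcal F,\mathcal E)$, with $H^\infty_{\mathcal B(\mathcal E)}(\mathbb D^n)=H^\infty_{\mathcal B(\mathcal E,\mathcal E)}(\mathbb D^n)$. A function $\Gamma\in H^\infty_{\mathcal B(\mathcal F,\mathcal E)}(\mathbb D^n)$ is called inner if its strong radial boundary values are isometric almost everywhere on the torus $\mathbb T^n$, that is, if for every $x\in\mathcal F$ the limit $\lim_{r\to1^-}\Gamma(r\boldsymbol\zeta)x$ exists and has norm $\|x\|$ for almost every $\boldsymbol\zeta\in\mathbb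 T^n$. (If $\mathcal F$ is separable, this says that $\Gamma$ has at almost every $\boldsymbol\zeta\in\mathbb T^n$ a strong radial limit $\Gamma(\boldsymbol\zeta)$ that is an isometry $\mathcal F\to\mathcal E$.) A bounded operator is a partial isometry if it is isometric on the orthogonal complement of its kernel. Let $\Phi\in H^\infty_{\mathcal B(\mathcal E)}(\mathbb D^n)$. Then the multiplication operator $M_\Phi f=\Phi f$ on $H^2_{\mathcal E}(\mathbb D^n)$ is a partial isometry if and only if there exist a Hilbert space $\mathcal F$, an inner function $\Gamma\in H^\infty_{\mathcal B(\mathcal F,\mathcal E)}(\mathbb D^n)$ and an isometry $V:\mathcal F\to\mathcal E$ such that $$\Phi(\boldsymbol z)=\Gamma(\boldsymbol z)V^*\qquad(\boldsymbol z\in\mathbb D^n).$$ -/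

import Mathlib

open Filter Topology MeasureTheory

universe u v

namespace PolydiscHardy

/-- The open unit polydisc `𝔻ⁿ` in `ℂⁿ`. -/
def polydisc (n : ℕ) : Set (Fin n → ℂ) := {z | ∀ i, ‖z i‖ < 1}

/-- The Hardy space `H²_E(𝔻ⁿ)` of power series `∑ aₖ zᵏ`, `k ∈ ℕⁿ`, with coefficients in `E` such
that `∑ ‖aₖ‖² < ∞`. An element is given by its family of coefficients; the inner product is
`⟪a, b⟫ = ∑ ⟪aₖ, bₖ⟫`. The corresponding analytic function on `𝔻ⁿ` is `HardySpace.eval`. -/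
abbrev HardySpace (n : ℕ) (E : Type u) [NormedAddCommGroup E] : Type u :=
  lp (fun _ : Fin n → ℕ => E) 2

/-- The value `f(z) = ∑ aₖ zᵏ` of `f ∈ H²_E(𝔻ⁿ)` at a point `z` (used for `z ∈ 𝔻ⁿ`, where the
series converges absolutely). -/
noncomputable def HardySpace.eval {n : ℕ} {E : Type u} [NormedAddCommGroup E]
    [InnerProductSpace ℂ E] (f : HardySpace n E) (z : Fin n → ℂ) : E :=
  ∑' k : Fin n → ℕ, (∏ i, z i ^ k i) • f k

/-- `Φ ∈ H^∞_{B(F,E)}(𝔻ⁿ)`: `Φ` is a bounded analytic function on `𝔻ⁿ` (for the operator norm).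
Only the values of `Φ` on the polydisc matter. -/
def MemHInfty {n : ℕ} {F : Type u} {E : Type v} [NormedAddCommGroup F] [InnerProductSpace ℂ F]
    [NormedAddCommGroup E] [InnerProductSpace ℂ E] (Φ : (Fin n → ℂ) → F →L[ℂ] E) : Prop :=
  AnalyticOnNhd ℂ Φ (polydisc n) ∧ ∃ C : ℝ, ∀ z ∈ polydisc n, ‖Φ z‖ ≤ C

/-- `T` is the multiplication operator `M_Φ : H²_F(𝔻ⁿ) → H²_E(𝔻ⁿ)`, `(M_Φ f)(z) = Φ(z) f(z)`. -/
def IsMultiplicationOperator {n : ℕ} {F : Type u} {E : Type v}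
    [NormedAddCommGroup F] [InnerProductSpace ℂ F]
    [NormedAddCommGroup E] [InnerProductSpace ℂ E] (Φ : (Fin n → ℂ) → F →L[ℂ] E)
    (T : HardySpace n F →L[ℂ] HardySpace n E) : Prop :=
  ∀ f : HardySpace n F, ∀ z ∈ polydisc n, (T f).eval z = Φ z (f.eval z)

/-- A bounded operator is a partial isometry if it is isometric on the orthogonal complement of
its kernel. -/
def IsPartialIsometry {H : Type u} {K : Type v} [NormedAddCommGroup H] [InnerProductSpace ℂ H]
    [NormedAddCommGroup K] [InnerProductSpace ℂ K] (T : H →L[ℂ] K) : Prop :=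
  ∀ f ∈ (LinearMap.ker (T : H →ₗ[ℂ] K))ᗮ, ‖T f‖ = ‖f‖

/-- The normalized Lebesgue (Haar) measure on the torus `𝕋ⁿ`, in angular coordinates `(ℝ/ℤ)ⁿ`. -/
noncomputable def torusMeasure (n : ℕ) : Measure (UnitAddTorus (Fin n)) :=
  Measure.pi fun _ => AddCircle.haarAddCircle

/-- The point `r ζ` of `ℂⁿ`, where `ζ = (e^{2πi t₁}, …, e^{2πi tₙ})` is the point of the torus `𝕋ⁿ`
with angular coordinates `t ∈ (ℝ/ℤ)ⁿ`. -/
noncomputable def dilate {n : ℕ} (r : ℝ) (t : UnitAddTorus (Fin n)) : Fin n → ℂ :=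
  fun i => (r : ℂ) * (AddCircle.toCircle (t i) : ℂ)

/-- `Γ ∈ H^∞_{B(F,E)}(𝔻ⁿ)` is inner if its boundary values on `𝕋ⁿ`, taken as strong radial limits,
are isometric almost everywhere (for the normalized Lebesgue measure of `𝕋ⁿ`): for every `x`, the
limit of `Γ(rζ)x` as `r → 1⁻` exists and has norm `‖x‖` for almost every `ζ`. If `F` is separable,
the exceptional null set can be chosen independently of `x`, so that this means that `Γ(ζ)` is an
isometry for almost every `ζ`; see `isInner_iff_ae_isometry`. For spaces that are not separable
the boundary values exist only vector by vector. -/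
def IsInner {n : ℕ} {F : Type u} {E : Type v} [NormedAddCommGroup F] [InnerProductSpace ℂ F]
    [NormedAddCommGroup E] [InnerProductSpace ℂ E] (Γ : (Fin n → ℂ) → F →L[ℂ] E) : Prop :=
  MemHInfty Γ ∧ ∀ x : F, ∀ᵐ t ∂torusMeasure n,
    ∃ y : E, Tendsto (fun r : ℝ => Γ (dilate r t) x) (𝓝[<] 1) (𝓝 y) ∧ ‖y‖ = ‖x‖

lemma dilate_mem_polydisc {n : ℕ} {r : ℝ} (h0 : 0 < r) (h1 : r < 1) (t : UnitAddTorus (Fin n)) :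
    dilate r t ∈ polydisc n := by
  intro i
  simp only [dilate, norm_mul, Complex.norm_real, Circle.norm_coe, mul_one, Real.norm_eq_abs,
    abs_of_pos h0]
  exact h1

/-- For separable `F`, a bounded analytic `Γ` is inner if and only if at almost every point of `𝕋ⁿ`
it has a strong radial limit that is an isometry `F → E`. -/
theorem isInner_iff_ae_isometry {n : ℕ} {F : Type u} {E : Type v} [NormedAddCommGroup F]
    [InnerProductSpace ℂ F] [TopologicalSpace.SeparableSpace F] [NormedAddCommGroup E]
    [InnerProductSpace ℂ E] [CompleteSpace E] (Γ : (Fin n → ℂ) → F →L[ℂ] E) :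
    IsInner Γ ↔ MemHInfty Γ ∧ ∀ᵐ t ∂torusMeasure n, ∃ U : F →ₗᵢ[ℂ] E, ∀ x : F,
      Tendsto (fun r : ℝ => Γ (dilate r t) x) (𝓝[<] 1) (𝓝 (U x)) := by
  constructor
  · rintro ⟨hΓ, h⟩
    refine ⟨hΓ, ?_⟩
    obtain ⟨C, hC⟩ := hΓ.2
    have hev : ∀ t : UnitAddTorus (Fin n), ∀ᶠ r : ℝ in 𝓝[<] 1, ‖Γ (dilate r t)‖ ≤ C := by
      intro t
      have h01 : Set.Ioo (0 : ℝ) 1 ∈ 𝓝[<] (1 : ℝ) := Ioo_mem_nhdsLT zero_lt_one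
      filter_upwards [h01] with r hr
      exact hC _ (dilate_mem_polydisc hr.1 hr.2 t)
    have hall : ∀ᵐ t ∂torusMeasure n, ∀ j : ℕ, ∃ y : E,
        Tendsto (fun r : ℝ => Γ (dilate r t) (TopologicalSpace.denseSeq F j)) (𝓝[<] 1) (𝓝 y) ∧
          ‖y‖ = ‖TopologicalSpace.denseSeq F j‖ := ae_all_iff.2 fun j => h _
    filter_upwards [hall] with t ht
    have hC0 : 0 ≤ C := by
      obtain ⟨r, hr⟩ := (hev t).exists
      exact (norm_nonneg _).trans hr
    have key : ∀ x : F, ∃ y : E, Tendsto (fun r : ℝ => Γ (dilate r t) x) (𝓝[<] 1) (𝓝 y) := by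
      intro x
      apply cauchy_map_iff_exists_tendsto.1
      rw [Metric.cauchy_iff]
      refine ⟨inferInstance, fun ε hε => ?_⟩
      obtain ⟨j, hj⟩ := (TopologicalSpace.denseRange_denseSeq F).exists_dist_lt x
        (show 0 < ε / (4 * (C + 1)) by positivity)
      obtain ⟨y, hy, -⟩ := ht j
      have h2 := Metric.tendsto_nhds.1 hy (ε / 4) (by positivity)
      have hs : ∀ᶠ r : ℝ in 𝓝[<] 1, dist (Γ (dilate r t) x) y < ε / 2 := by
        filter_upwards [h2, hev t] with r hr1 hr2
        have h3 : dist (Γ (dilate r t) x) (Γ (dilate r t) (TopologicalSpace.denseSeq F j))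
            ≤ ε / 4 := by
          rw [dist_eq_norm, ← map_sub]
          refine (ContinuousLinearMap.le_opNorm _ _).trans ?_
          rw [← dist_eq_norm]
          calc ‖Γ (dilate r t)‖ * dist x (TopologicalSpace.denseSeq F j)
              ≤ (C + 1) * (ε / (4 * (C + 1))) :=
                mul_le_mul (by linarith) hj.le dist_nonneg (by linarith)
            _ = ε / 4 := by field_simp
        have := dist_triangle (Γ (dilate r t) x) (Γ (dilate r t) (TopologicalSpace.denseSeq F j)) y
        linarith
      refine ⟨Metric.ball y (ε / 2), hs, fun a ha b hb => ?_⟩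
      have := dist_triangle_right a b y
      rw [Metric.mem_ball] at ha hb
      linarith
    choose U hU using key
    have hdense : ∀ j, ‖U (TopologicalSpace.denseSeq F j)‖ = ‖TopologicalSpace.denseSeq F j‖ := by
      intro j
      obtain ⟨y, hy, hn⟩ := ht j
      rw [tendsto_nhds_unique (hU _) hy, hn]
    let L : F →ₗ[ℂ] E :=
      { toFun := U
        map_add' := fun x y => tendsto_nhds_unique (hU (x + y))
          (by simpa only [map_add] using (hU x).add (hU y))
        map_smul' := fun c x => tendsto_nhds_unique (hU (c • x))
          (by simpa only [map_smul, RingHom.id_apply] using (hU x).const_smul c) }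
    have hbound : ∀ x, ‖L x‖ ≤ C * ‖x‖ := by
      intro x
      refine le_of_tendsto (hU x).norm ?_
      filter_upwards [hev t] with r hr
      exact (ContinuousLinearMap.le_opNorm _ _).trans
        (mul_le_mul_of_nonneg_right hr (norm_nonneg _))
    have hcont : Continuous L := (L.mkContinuous C hbound).continuous
    have hnorm : (fun x => ‖L x‖) = fun x => ‖x‖ :=
      (TopologicalSpace.denseRange_denseSeq F).equalizer hcont.norm continuous_norm
        (funext hdense)
    exact ⟨⟨L, fun x => congrFun hnorm x⟩, hU⟩
  · rintro ⟨hΓ, h⟩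
    refine ⟨hΓ, fun x => ?_⟩
    filter_upwards [h] with t ht
    obtain ⟨U, hU⟩ := ht
    exact ⟨U x, hU x, U.norm_map x⟩

end PolydiscHardy

open PolydiscHardy

/-! Write T for multiplication by Φ. It commutes with multiplication by each monomial, and these
shifts are isometries of H². Let T be a partial isometry. Its kernel is shift invariant, and so is
the orthogonal complement, since that consists exactly of the vectors whose norm T preserves
(`IsPartialIsometry.mem_orthogonal_ker`) and a shift changes neither norm. Hence the kernel reduces
all shifts and the projection onto it sends constants to constants
(`exists_constant_decomposition`). Let F be the space of constants orthogonal to the kernel, V its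
inclusion and Γ the restriction of Φ to F. Then Φ vanishes on the complement of F, which is the
identity Φ = Γ V*.

To see that Γ is inner, test T on Szegő kernels: a contractive multiplier is contractive at every
point (`norm_le_one_of_contractive`). Since T is isometric on the constants from F, the boundary
function of Γx has mean square ‖x‖²; being bounded by ‖x‖, it has norm ‖x‖ almost everywhere
(`isInner_of_norm_eq`).

The existence of radial limits is Fatou's theorem for Hilbert space values. On the disc, an L² limit
of dilations gives a boundary function, and the Poisson integral, integrated by parts, converges
wherever the primitive of that function is differentiable with the expected derivative. On the
polydisc, the disc theorem is applied to the slices l ↦ h(l ζ), and Fubini together with translation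
invariance gives almost every point of the torus.

Conversely, for inner Γ the functions zʲ Γx have norm ‖x‖ and are orthogonal for different j, by
passing to the limit in integrals over tori. So multiplication by Γ is an isometry M, and M composed
with the coefficientwise coisometry V* is a partial isometry. That zʲ Γx lies in H² at all is
`exists_hardySpace_eval_eq`. -/

namespace PolydiscHardy

open scoped ComplexConjugate InnerProductSpace

/-! ### Parseval's identity for Hilbert space valued series. -/

section Parseval

variable {E : Type*} [NormedAddCommGroup E] [InnerProductSpace ℂ E] [CompleteSpace E]

lemma summable_unimodular_smul {ι : Type*} {e : ι → ℂ} {a : ι → E} (he : ∀ k, ‖e k‖ = 1)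
    (ha : Summable fun k => ‖a k‖) : Summable fun k => e k • a k :=
  Summable.of_norm (by simpa [norm_smul, he] using ha)

/-- Parseval's identity for absolutely convergent series with coefficients in a Hilbert space. -/
theorem integral_inner_tsum {X ι : Type*} [MeasurableSpace X] [Countable ι] [DecidableEq ι]
    {μ : Measure X} [IsFiniteMeasure μ] {e : ι → X → ℂ} {c : ℂ}
    (hm : ∀ k, AEStronglyMeasurable (e k) μ) (he : ∀ k x, ‖e k x‖ = 1)
    (ho : ∀ k l, ∫ x, conj (e k x) * e l x ∂μ = if k = l then c else 0) {a b : ι → E}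
    (ha : Summable fun k => ‖a k‖) (hb : Summable fun k => ‖b k‖) :
    ∫ x, ⟪∑' k, e k x • a k, ∑' k, e k x • b k⟫_ℂ ∂μ = c * ∑' k, ⟪a k, b k⟫_ℂ := by
  have hab : Summable fun p : ι × ι => ‖a p.1‖ * ‖b p.2‖ :=
    ha.mul_of_nonneg hb (fun _ => norm_nonneg _) fun _ => norm_nonneg _
  have hnorm : ∀ (p : ι × ι) x, ‖conj (e p.1 x) * e p.2 x * ⟪a p.1, b p.2⟫_ℂ‖ ≤
      ‖a p.1‖ * ‖b p.2‖ := by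
    intro p x
    rw [norm_mul, norm_mul, RCLike.norm_conj, he, he, one_mul, one_mul]
    exact norm_inner_le_norm _ _
  have hpt : ∀ x, ⟪∑' k, e k x • a k, ∑' k, e k x • b k⟫_ℂ =
      ∑' p : ι × ι, conj (e p.1 x) * e p.2 x * ⟪a p.1, b p.2⟫_ℂ := by
    intro x
    have hs : Summable fun p : ι × ι => conj (e p.1 x) * e p.2 x * ⟪a p.1, b p.2⟫_ℂ :=
      Summable.of_norm_bounded hab fun p => hnorm p x
    have hA := (summable_unimodular_smul (fun k => he k x) ha).hasSum
    have hB := (summable_unimodular_smul (fun k => he k x) hb).hasSum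
    rw [hs.tsum_prod]
    have h1 : ∀ k, ∑' l, conj (e k x) * e l x * ⟪a k, b l⟫_ℂ =
        ⟪e k x • a k, ∑' l, e l x • b l⟫_ℂ := by
      intro k
      have := (hB.mapL (innerSL ℂ (e k x • a k))).tsum_eq
      simp only [innerSL_apply_apply, inner_smul_left, inner_smul_right] at this
      rw [inner_smul_left, ← this]
      exact tsum_congr fun l => by ring
    simp only [h1]
    have h2 := (hA.mapL (innerSL ℂ (∑' l, e l x • b l))).tsum_eq
    simp only [innerSL_apply_apply] at h2
    rw [← inner_conj_symm, ← h2, Complex.conj_tsum]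
    exact tsum_congr fun k => inner_conj_symm _ _
  simp_rw [hpt]
  -- The double series is dominated by the summable family ‖a k‖ ‖b l‖, so it may be integrated
  -- termwise; orthogonality then leaves only the diagonal.
  rw [← integral_tsum_of_summable_integral_norm]
  · have hint : ∀ p : ι × ι, ∫ x, conj (e p.1 x) * e p.2 x * ⟪a p.1, b p.2⟫_ℂ ∂μ =
        if p.1 = p.2 then c * ⟪a p.1, b p.2⟫_ℂ else 0 := by
      intro p
      rw [integral_mul_const, ho]
      split_ifs <;> simp
    simp_rw [hint]
    rw [← tsum_mul_left]
    have hinj : Function.Injective fun k : ι => (k, k) := fun k l h => (Prod.ext_iff.1 h).1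
    rw [← hinj.tsum_eq]
    · simp
    · rintro ⟨k, l⟩ hp
      rw [Function.mem_support] at hp
      by_cases h : k = l
      · exact ⟨k, by simp [h]⟩
      · simp [h] at hp
  · intro p
    refine Integrable.of_bound ?_ (‖a p.1‖ * ‖b p.2‖) (.of_forall fun x => hnorm p x)
    exact ((Complex.continuous_conj.comp_aestronglyMeasurable (hm p.1)).mul (hm p.2)).mul_const _
  · refine Summable.of_nonneg_of_le (fun p => integral_nonneg fun x => norm_nonneg _)
      (fun p => ?_) (hab.mul_left (μ.real Set.univ))
    calc ∫ x, ‖conj (e p.1 x) * e p.2 x * ⟪a p.1, b p.2⟫_ℂ‖ ∂μ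
        ≤ ∫ _, ‖a p.1‖ * ‖b p.2‖ ∂μ :=
          integral_mono_of_nonneg (.of_forall fun x => norm_nonneg _) (integrable_const _)
            (.of_forall fun x => hnorm p x)
      _ = _ := by simp

/-- The constant `c` is the total mass: 1 for the torus, 2π for Lebesgue measure on (0, 2π]. -/
theorem integral_norm_sq_tsum {X ι : Type*} [MeasurableSpace X] [Countable ι] [DecidableEq ι]
    {μ : Measure X} [IsFiniteMeasure μ] {e : ι → X → ℂ} {c : ℝ}
    (hm : ∀ k, AEStronglyMeasurable (e k) μ) (he : ∀ k x, ‖e k x‖ = 1)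
    (ho : ∀ k l, ∫ x, conj (e k x) * e l x ∂μ = if k = l then (c : ℂ) else 0) {a : ι → E}
    (ha : Summable fun k => ‖a k‖) :
    ∫ x, ‖∑' k, e k x • a k‖ ^ 2 ∂μ = c * ∑' k, ‖a k‖ ^ 2 := by
  have h := integral_inner_tsum hm he ho ha ha
  simp only [inner_self_eq_norm_sq_to_K] at h
  apply Complex.ofReal_injective
  rw [← integral_complex_ofReal]
  push_cast [Complex.ofReal_tsum]
  exact h

end Parseval

/-- Any finite set of exponents lies in a box, and over a box the sum factors into partial sums of
geometric series. -/
lemma summable_prod_pow {n : ℕ} {x : Fin n → ℝ} (h0 : ∀ i, 0 ≤ x i) (h1 : ∀ i, x i < 1) :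
    Summable fun k : Fin n → ℕ => ∏ i, x i ^ k i := by
  refine summable_of_sum_le (c := ∏ i, (1 - x i)⁻¹)
    (fun k => Finset.prod_nonneg fun i _ => pow_nonneg (h0 i) _) fun s => ?_
  obtain ⟨N, hN⟩ : ∃ N, s ⊆ Fintype.piFinset fun _ : Fin n => Finset.range N := by
    refine ⟨s.sup (fun k => Finset.univ.sup k) + 1, fun k hk => ?_⟩
    simp only [Fintype.mem_piFinset, Finset.mem_range, Nat.lt_succ_iff]
    intro i
    exact (Finset.le_sup (f := k) (Finset.mem_univ i)).trans
      (Finset.le_sup (f := fun k : Fin n → ℕ => Finset.univ.sup k) hk)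
  calc ∑ k ∈ s, ∏ i, x i ^ k i
      ≤ ∑ k ∈ Fintype.piFinset fun _ : Fin n => Finset.range N, ∏ i, x i ^ k i :=
        Finset.sum_le_sum_of_subset_of_nonneg hN fun k _ _ =>
          Finset.prod_nonneg fun i _ => pow_nonneg (h0 i) _
    _ = ∏ i, ∑ j ∈ Finset.range N, x i ^ j := (Finset.prod_univ_sum _ _).symm
    _ ≤ ∏ i, (1 - x i)⁻¹ := by
        refine Finset.prod_le_prod (fun i _ => Finset.sum_nonneg fun j _ => pow_nonneg (h0 i) _)
          fun i _ => ?_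
        rw [← tsum_geometric_of_lt_one (h0 i) (h1 i)]
        exact (summable_geometric_of_lt_one (h0 i) (h1 i)).sum_le_tsum _
          fun j _ => pow_nonneg (h0 i) _

/-! ### Orthonormality of the monomials on the torus. -/

section Torus

variable {n : ℕ}

/-- The monomial `ζ ↦ ζᵏ` on the torus, in angular coordinates. -/
noncomputable def torusMonomial (k : Fin n → ℕ) (t : UnitAddTorus (Fin n)) : ℂ :=
  ∏ i, (AddCircle.toCircle (t i) : ℂ) ^ k i

instance : IsProbabilityMeasure (torusMeasure n) := by
  unfold torusMeasure; infer_instance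

lemma norm_torusMonomial (k : Fin n → ℕ) (t : UnitAddTorus (Fin n)) :
    ‖torusMonomial k t‖ = 1 := by
  simp only [torusMonomial, norm_prod, norm_pow, Circle.norm_coe, one_pow, Finset.prod_const_one]

lemma continuous_torusMonomial (k : Fin n → ℕ) : Continuous (torusMonomial k) := by
  unfold torusMonomial
  refine continuous_finsetProd _ fun i _ => Continuous.pow ?_ _
  exact continuous_subtype_val.comp (AddCircle.continuous_toCircle.comp (continuous_apply i))

lemma prod_dilate_pow (r : ℝ) (t : UnitAddTorus (Fin n)) (k : Fin n → ℕ) :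
    ∏ i, dilate r t i ^ k i = (r : ℂ) ^ (∑ i, k i) * torusMonomial k t := by
  simp only [dilate, mul_pow, Finset.prod_mul_distrib, torusMonomial, Finset.prod_pow_eq_pow_sum]

/-- The integral over the product measure factors over the coordinates, which reduces it to the
orthonormality of the Fourier characters on the circle. -/
lemma integral_conj_mul_torusMonomial (k l : Fin n → ℕ) :
    ∫ t, conj (torusMonomial k t) * torusMonomial l t ∂torusMeasure n =
      if k = l then ((1 : ℝ) : ℂ) else 0 := by
  have h1 : ∀ i j : ℕ, ∫ s : UnitAddCircle, conj ((AddCircle.toCircle s : ℂ) ^ i) *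
      (AddCircle.toCircle s : ℂ) ^ j ∂AddCircle.haarAddCircle = if i = j then 1 else 0 := by
    intro i j
    have := orthonormal_iff_ite.1 (orthonormal_fourier (T := 1)) i j
    rw [ContinuousMap.inner_toLp] at this
    simp only [fourier_apply, Nat.cast_inj] at this
    rw [← this]
    refine integral_congr_ae (.of_forall fun s => ?_)
    simp [mul_comm, AddCircle.toCircle_nsmul]
  have h2 : ∀ t : UnitAddTorus (Fin n), conj (torusMonomial k t) * torusMonomial l t =
      ∏ i, (conj ((AddCircle.toCircle (t i) : ℂ) ^ k i) * (AddCircle.toCircle (t i) : ℂ) ^ l i) := by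
    intro t
    rw [torusMonomial, torusMonomial, map_prod, Finset.prod_mul_distrib]
  simp_rw [h2]
  rw [torusMeasure, integral_fintype_prod_eq_prod (𝕜 := ℂ)
    (f := fun i (s : UnitAddCircle) => conj ((AddCircle.toCircle s : ℂ) ^ k i) *
      (AddCircle.toCircle s : ℂ) ^ l i)]
  simp_rw [h1]
  by_cases h : k = l
  · simp [h]
  · obtain ⟨i, hi⟩ := Function.ne_iff.1 h
    rw [if_neg h]
    exact Finset.prod_eq_zero (Finset.mem_univ i) (if_neg hi)

end Torus

/-! ### Point evaluations, Szegő kernels and L² means on the Hardy space. -/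

namespace HardySpace

variable {n : ℕ} {E : Type*}

lemma hasSum_norm_sq [NormedAddCommGroup E] (f : HardySpace n E) : HasSum (fun k => ‖f k‖ ^ 2) (‖f‖ ^ 2) := by
  have := lp.hasSum_norm (p := 2) (by norm_num) f
  simpa using this

variable [NormedAddCommGroup E] [InnerProductSpace ℂ E]

lemma summable_monomial {z : Fin n → ℂ} (hz : z ∈ polydisc n) :
    Summable fun k : Fin n → ℕ => ‖∏ i, z i ^ k i‖ := by
  simpa [norm_prod] using summable_prod_pow (fun i => norm_nonneg (z i)) hz

lemma summable_norm_eval (f : HardySpace n E) {z : Fin n → ℂ} (hz : z ∈ polydisc n) :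
    Summable fun k : Fin n → ℕ => ‖(∏ i, z i ^ k i) • f k‖ := by
  refine Summable.of_nonneg_of_le (fun k => norm_nonneg _) (fun k => ?_)
    ((summable_monomial hz).mul_right ‖f‖)
  rw [norm_smul]
  exact mul_le_mul_of_nonneg_left (lp.norm_apply_le_norm (by simp) f k) (norm_nonneg _)

@[simp]
lemma eval_single (k : Fin n → ℕ) (x : E) (z : Fin n → ℂ) :
    eval (lp.single 2 k x : HardySpace n E) z = (∏ i, z i ^ k i) • x := by
  rw [eval, tsum_eq_single k]
  · rw [lp.single_apply_self]
  · intro l hl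
    rw [lp.single_apply_ne _ _ _ hl, smul_zero]

/-- The Szegő kernel vector `∑ₖ conj(z)ᵏ y ζᵏ`. -/
noncomputable def szego {z : Fin n → ℂ} (hz : z ∈ polydisc n) (y : E) : HardySpace n E :=
  ⟨fun k => conj (∏ i, z i ^ k i) • y, by
    refine memℓp_gen (Summable.of_nonneg_of_le (fun k => by positivity) (fun k => ?_)
      ((summable_monomial hz).mul_right (‖y‖ ^ 2)))
    have h1 : ‖∏ i, z i ^ k i‖ ≤ 1 := by
      rw [norm_prod]
      refine Finset.prod_le_one (fun i _ => norm_nonneg _) fun i _ => ?_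
      rw [norm_pow]
      exact pow_le_one₀ (norm_nonneg _) (hz i).le
    rw [norm_smul, RCLike.norm_conj]
    simp only [ENNReal.toReal_ofNat, Real.rpow_ofNat, mul_pow]
    refine mul_le_mul_of_nonneg_right ?_ (by positivity)
    exact pow_le_of_le_one (norm_nonneg _) h1 two_ne_zero⟩

lemma szego_apply {z : Fin n → ℂ} (hz : z ∈ polydisc n) (y : E) (k : Fin n → ℕ) :
    szego hz y k = conj (∏ i, z i ^ k i) • y := rfl

lemma eval_dilate (f : HardySpace n E) (r : ℝ) (t : UnitAddTorus (Fin n)) :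
    f.eval (dilate r t) = ∑' k, torusMonomial k t • ((r : ℂ) ^ (∑ i, k i) • f k) := by
  rw [eval]
  refine tsum_congr fun k => ?_
  rw [prod_dilate_pow, smul_smul, mul_comm]

lemma summable_norm_dilate (f : HardySpace n E) {r : ℝ} (hr : r ∈ Set.Ioo (0 : ℝ) 1) :
    Summable fun k : Fin n → ℕ => ‖(r : ℂ) ^ (∑ i, k i) • f k‖ := by
  have := summable_norm_eval f (dilate_mem_polydisc hr.1 hr.2 0)
  simpa only [prod_dilate_pow, norm_smul, norm_mul, norm_torusMonomial, mul_one] using this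

variable [CompleteSpace E]

lemma hasSum_eval (f : HardySpace n E) {z : Fin n → ℂ} (hz : z ∈ polydisc n) :
    HasSum (fun k : Fin n → ℕ => (∏ i, z i ^ k i) • f k) (f.eval z) :=
  (summable_norm_eval f hz).of_norm.hasSum

/-- Evaluation at a point of the polydisc, as a bounded linear map. -/
noncomputable def evalCLM (E : Type*) [NormedAddCommGroup E] [InnerProductSpace ℂ E]
    [CompleteSpace E] {z : Fin n → ℂ} (hz : z ∈ polydisc n) : HardySpace n E →L[ℂ] E :=
  LinearMap.mkContinuous
    { toFun := fun f => f.eval z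
      map_add' := fun f g => by
        rw [← ((hasSum_eval f hz).add (hasSum_eval g hz)).tsum_eq]
        simp [eval, smul_add]
      map_smul' := fun c f => by
        rw [RingHom.id_apply, ← ((hasSum_eval f hz).const_smul c).tsum_eq]
        simp only [eval, lp.coeFn_smul, Pi.smul_apply, smul_comm c] }
    (∑' k : Fin n → ℕ, ‖∏ i, z i ^ k i‖) fun f => by
      refine tsum_of_norm_bounded ((summable_monomial hz).hasSum.mul_right ‖f‖) fun k => ?_
      rw [norm_smul]
      exact mul_le_mul_of_nonneg_left (lp.norm_apply_le_norm (by simp) f k) (norm_nonneg _)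

@[simp]
lemma evalCLM_apply {z : Fin n → ℂ} (hz : z ∈ polydisc n) (f : HardySpace n E) :
    evalCLM E hz f = f.eval z := rfl

lemma inner_szego {z : Fin n → ℂ} (hz : z ∈ polydisc n) (y : E) (f : HardySpace n E) :
    ⟪szego hz y, f⟫_ℂ = ⟪y, f.eval z⟫_ℂ := by
  rw [lp.inner_eq_tsum]
  have := ((hasSum_eval f hz).mapL (innerSL ℂ y)).tsum_eq
  simp only [innerSL_apply_apply] at this
  rw [← this]
  refine tsum_congr fun k => ?_
  rw [szego_apply, inner_smul_left, inner_smul_right, Complex.conj_conj]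

/-- A contractive multiplier is bounded by `1` in norm at every point. -/
theorem norm_le_one_of_contractive {F : Type*} [NormedAddCommGroup F] [InnerProductSpace ℂ F]
    [CompleteSpace F] {Φ : (Fin n → ℂ) → F →L[ℂ] E} {T : HardySpace n F →L[ℂ] HardySpace n E}
    (hT : IsMultiplicationOperator Φ T) (hc : ∀ f, ‖T f‖ ≤ ‖f‖) {z : Fin n → ℂ}
    (hz : z ∈ polydisc n) (x : F) : ‖Φ z x‖ ≤ ‖x‖ := by
  -- `K` is the Szegő kernel at (z, z). The vector `szego hz x` takes the value K x at z, so y, the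
  -- value of its image, is K Φ(z)x. The reproducing property gives ‖y‖² = ⟪`szego hz y`, T(`szego
  -- hz x`)⟫ ≤ K ‖y‖ ‖x‖, and dividing by K ‖y‖ finishes.
  set K : ℝ := ∑' k : Fin n → ℕ, ‖∏ i, z i ^ k i‖ ^ 2 with hK
  have hsum : Summable fun k : Fin n → ℕ => ‖∏ i, z i ^ k i‖ ^ 2 := by
    have := (hasSum_norm_sq (szego hz (1 : ℂ))).summable
    simpa [szego_apply] using this
  have hK1 : 0 < K := by
    refine hsum.tsum_pos (fun k => by positivity) 0 ?_
    simp
  have hnormE : ∀ y : E, ‖szego hz y‖ ^ 2 = K * ‖y‖ ^ 2 := by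
    intro y
    rw [← (hasSum_norm_sq (szego hz y)).tsum_eq, hK, ← tsum_mul_right]
    simp [szego_apply, norm_smul, mul_pow]
  have hnormF : ‖szego hz x‖ ^ 2 = K * ‖x‖ ^ 2 := by
    rw [← (hasSum_norm_sq (szego hz x)).tsum_eq, hK, ← tsum_mul_right]
    simp [szego_apply, norm_smul, mul_pow]
  have hev : (szego hz x).eval z = (K : ℂ) • x := by
    rw [eval, hK, Complex.ofReal_tsum, ← Summable.tsum_smul_const]
    · refine tsum_congr fun k => ?_
      rw [szego_apply, smul_smul, Complex.mul_conj, Complex.normSq_eq_norm_sq]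
    · exact_mod_cast Complex.hasSum_ofReal.2 hsum.hasSum |>.summable
  set y := (T (szego hz x)).eval z with hy
  have hy' : ‖y‖ = K * ‖Φ z x‖ := by
    rw [hy, hT _ _ hz, hev, map_smul, norm_smul, Complex.norm_real, Real.norm_of_nonneg hK1.le]
  have h1 : ‖y‖ ^ 2 ≤ ‖szego hz y‖ * ‖szego hz x‖ := by
    have h2 : ⟪szego hz y, T (szego hz x)⟫_ℂ = (‖y‖ : ℂ) ^ 2 := by
      rw [inner_szego, ← hy]; exact inner_self_eq_norm_sq_to_K _
    have h3 := norm_inner_le_norm (𝕜 := ℂ) (szego hz y) (T (szego hz x))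
    rw [h2, norm_pow, Complex.norm_real, norm_norm] at h3
    exact h3.trans (mul_le_mul_of_nonneg_left (hc _) (norm_nonneg _))
  have h4 : ‖y‖ ^ 2 * ‖y‖ ^ 2 ≤ (K * ‖x‖) ^ 2 * ‖y‖ ^ 2 := by
    calc ‖y‖ ^ 2 * ‖y‖ ^ 2 ≤ (‖szego hz y‖ * ‖szego hz x‖) * (‖szego hz y‖ * ‖szego hz x‖) :=
          mul_le_mul h1 h1 (by positivity) (by positivity)
      _ = ‖szego hz y‖ ^ 2 * ‖szego hz x‖ ^ 2 := by ring
      _ = _ := by rw [hnormE, hnormF]; ring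
  rcases (norm_nonneg y).eq_or_lt with h | h
  · rw [← h] at hy'
    have : ‖Φ z x‖ = 0 := by
      rcases mul_eq_zero.1 hy'.symm with h | h
      · exact absurd h hK1.ne'
      · exact h
    rw [this]; exact norm_nonneg _
  · have h5 := le_of_mul_le_mul_right h4 (by positivity)
    have h6 := (sq_le_sq₀ h.le (by positivity)).1 h5
    rw [hy'] at h6
    exact le_of_mul_le_mul_left h6 hK1

lemma integral_inner_dilate (f g : HardySpace n E) {r : ℝ} (hr : r ∈ Set.Ioo (0 : ℝ) 1) :
    ∫ t, ⟪f.eval (dilate r t), g.eval (dilate r t)⟫_ℂ ∂torusMeasure n =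
      ∑' k : Fin n → ℕ, ((r : ℂ) ^ (∑ i, k i)) ^ 2 * ⟪f k, g k⟫_ℂ := by
  simp_rw [eval_dilate]
  rw [integral_inner_tsum (fun k => (continuous_torusMonomial k).aestronglyMeasurable)
    norm_torusMonomial integral_conj_mul_torusMonomial (summable_norm_dilate f hr)
    (summable_norm_dilate g hr), Complex.ofReal_one, one_mul]
  refine tsum_congr fun k => ?_
  rw [inner_smul_left, inner_smul_right, map_pow, Complex.conj_ofReal]
  ring

/-- The inner product of the Hardy space is the limit of the `L²` inner products over the tori of
radius `r < 1`. -/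
theorem tendsto_integral_inner_dilate (f g : HardySpace n E) :
    Tendsto (fun r : ℝ => ∫ t, ⟪f.eval (dilate r t), g.eval (dilate r t)⟫_ℂ ∂torusMeasure n)
      (𝓝[<] 1) (𝓝 ⟪f, g⟫_ℂ) := by
  have h01 : Set.Ioo (0 : ℝ) 1 ∈ 𝓝[<] (1 : ℝ) := Ioo_mem_nhdsLT zero_lt_one
  have hs : Summable fun k : Fin n → ℕ => ‖⟪f k, g k⟫_ℂ‖ :=
    summable_norm_iff.2 (lp.summable_inner (𝕜 := ℂ) f g)
  have h1 : Tendsto (fun r : ℝ => ∑' k : Fin n → ℕ, ((r : ℂ) ^ (∑ i, k i)) ^ 2 * ⟪f k, g k⟫_ℂ)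
      (𝓝[<] 1) (𝓝 (∑' k, ⟪f k, g k⟫_ℂ)) := by
    refine tendsto_tsum_of_dominated_convergence hs (fun k => ?_) ?_
    · have : Continuous fun r : ℝ => ((r : ℂ) ^ (∑ i, k i)) ^ 2 * ⟪f k, g k⟫_ℂ := by fun_prop
      have h := this.tendsto 1
      simp only [Complex.ofReal_one, one_pow, one_mul] at h
      exact h.mono_left nhdsWithin_le_nhds
    · filter_upwards [h01] with r hr k
      rw [norm_mul, norm_pow, norm_pow, Complex.norm_real, Real.norm_of_nonneg hr.1.le]
      exact mul_le_of_le_one_left (norm_nonneg _)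
        (pow_le_one₀ (by have := hr.1; positivity) (pow_le_one₀ hr.1.le hr.2.le))
  rw [lp.inner_eq_tsum]
  refine h1.congr' ?_
  filter_upwards [h01] with r hr using (integral_inner_dilate f g hr).symm

theorem tendsto_integral_norm_sq_dilate (f : HardySpace n E) :
    Tendsto (fun r : ℝ => ∫ t, ‖f.eval (dilate r t)‖ ^ 2 ∂torusMeasure n)
      (𝓝[<] 1) (𝓝 (‖f‖ ^ 2)) := by
  have h := (Complex.continuous_re.tendsto _).comp (tendsto_integral_inner_dilate f f)
  rw [inner_self_eq_norm_sq_to_K] at h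
  convert h using 1
  · ext r
    simp only [Function.comp_apply, inner_self_eq_norm_sq_to_K]
    have : ∀ x : ℝ, (x : ℂ) ^ 2 = ((x ^ 2 : ℝ) : ℂ) := fun x => by push_cast; rfl
    change _ = (∫ t, ((‖f.eval (dilate r t)‖ : ℝ) : ℂ) ^ 2 ∂torusMeasure n).re
    simp_rw [this]
    rw [integral_complex_ofReal, Complex.ofReal_re]
  · congr 1
    change _ = (((‖f‖ : ℝ) : ℂ) ^ 2).re
    rw [← Complex.ofReal_pow, Complex.ofReal_re]

/-- An element of the Hardy space is determined by its values on the polydisc. -/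
theorem eval_ext {f g : HardySpace n E} (h : ∀ z ∈ polydisc n, f.eval z = g.eval z) : f = g := by
  rw [← sub_eq_zero, ← norm_eq_zero, ← sq_eq_zero_iff]
  -- The L² means of f - g vanish on every torus of radius r < 1, while they tend to ‖f - g‖².
  refine tendsto_nhds_unique (tendsto_integral_norm_sq_dilate (f - g))
    ((tendsto_const_nhds (x := (0 : ℝ))).congr' ?_)
  filter_upwards [Ioo_mem_nhdsLT zero_lt_one] with r hr
  have : ∀ t, (f - g).eval (dilate r t) = 0 := fun t => by
    have hz := dilate_mem_polydisc hr.1 hr.2 t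
    rw [← evalCLM_apply hz, map_sub, evalCLM_apply, evalCLM_apply, h _ hz, sub_self]
  simp [this]

end HardySpace

/-- Fatou's lemma for the coefficients of the dilations of a power series. -/
lemma sum_norm_sq_le_of_dilates {ι E : Type*} [NormedAddCommGroup E] [NormedSpace ℂ E] {d : ι → ℕ}
    {a : ι → E} {s : Finset ι} {B : ℝ}
    (h : ∀ r ∈ Set.Ioo (0 : ℝ) 1, ∑ k ∈ s, ‖(r : ℂ) ^ d k • a k‖ ^ 2 ≤ B) :
    ∑ k ∈ s, ‖a k‖ ^ 2 ≤ B := by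
  have hlim : Tendsto (fun r : ℝ => ∑ k ∈ s, ‖(r : ℂ) ^ d k • a k‖ ^ 2) (𝓝[<] 1)
      (𝓝 (∑ k ∈ s, ‖a k‖ ^ 2)) := by
    have hc : Continuous fun r : ℝ => ∑ k ∈ s, ‖(r : ℂ) ^ d k • a k‖ ^ 2 := by fun_prop
    have := hc.tendsto 1
    simp only [Complex.ofReal_one, one_pow, one_smul] at this
    exact this.mono_left nhdsWithin_le_nhds
  exact le_of_tendsto hlim
    (by filter_upwards [Ioo_mem_nhdsLT zero_lt_one] with r hr using h r hr)

lemma summable_sq_of_summable {ι : Type*} {u : ι → ℝ} (h0 : ∀ k, 0 ≤ u k) (hu : Summable u) :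
    Summable fun k => u k ^ 2 := by
  simpa only [pow_two, Function.comp_def] using
    (hu.mul_of_nonneg hu h0 h0).comp_injective (i := fun k => (k, k))
      fun k l h => (Prod.ext_iff.1 h).1

/-! ### Taylor coefficients of bounded holomorphic functions on the disc. -/

section Taylor

variable {E : Type*} [NormedAddCommGroup E] [InnerProductSpace ℂ E] [CompleteSpace E]

/-- Cauchy's estimate on the circle of radius R gives C / R ^ m; let R tend to 1. -/
lemma norm_taylorCoeff_le {f : ℂ → E} {C : ℝ} (hf : DifferentiableOn ℂ f (Metric.ball 0 1))
    (hC : ∀ z ∈ Metric.ball (0 : ℂ) 1, ‖f z‖ ≤ C) (m : ℕ) :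
    ‖((m.factorial : ℂ)⁻¹ • iteratedDeriv m f 0)‖ ≤ C := by
  have h : ∀ R ∈ Set.Ioo (0 : ℝ) 1, ‖((m.factorial : ℂ)⁻¹ • iteratedDeriv m f 0)‖ ≤ C / R ^ m := by
    intro R hR
    have h1 := Complex.norm_iteratedDeriv_le_of_forall_mem_sphere_norm_le (C := C) m hR.1
      ((hf.mono (Metric.closedBall_subset_ball hR.2)).diffContOnCl_ball subset_rfl)
      fun z hz => hC z (Metric.closedBall_subset_ball hR.2 (Metric.sphere_subset_closedBall hz))
    rw [norm_smul, norm_inv, Complex.norm_natCast, inv_mul_le_iff₀ (by positivity)]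
    rwa [mul_div_assoc] at h1
  have hlim : Tendsto (fun R : ℝ => C / R ^ m) (𝓝[<] 1) (𝓝 (C / 1 ^ m)) := by
    refine (ContinuousAt.tendsto ?_).mono_left nhdsWithin_le_nhds
    exact ContinuousAt.div continuousAt_const (by fun_prop) (by simp)
  rw [one_pow, div_one] at hlim
  exact ge_of_tendsto hlim (by filter_upwards [Ioo_mem_nhdsLT zero_lt_one] with R hR using h R hR)

lemma hasSum_taylorCoeff {f : ℂ → E} (hf : DifferentiableOn ℂ f (Metric.ball 0 1)) {z : ℂ}
    (hz : z ∈ Metric.ball (0 : ℂ) 1) :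
    HasSum (fun m : ℕ => z ^ m • ((m.factorial : ℂ)⁻¹ • iteratedDeriv m f 0)) (f z) := by
  have := Complex.hasSum_taylorSeries_on_ball hf hz
  simp only [sub_zero] at this
  simpa only [smul_comm (z ^ _)] using this

end Taylor

/-! ### Monomial coefficients of homogeneous polynomials. -/

section Homogeneous

variable {n : ℕ} {E : Type*} [NormedAddCommGroup E] [NormedSpace ℂ E]

/-- The coefficient of `zᵏ` in the homogeneous polynomial `p(z, …, z)`. -/
noncomputable def monomialCoeff {m : ℕ} (p : (Fin n → ℂ) [×m]→L[ℂ] E) (k : Fin n → ℕ) : E :=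
  ∑ f : Fin m → Fin n with (fun i => (Finset.univ.filter fun j => f j = i).card) = k,
    p fun j => Pi.single (f j) 1

/-- Expand z in the standard basis by multilinearity and group the index maps by how often they take
each value. No symmetry of `p` is needed, because all index maps of a given type are summed. -/
lemma apply_diag_eq_sum_monomialCoeff {m : ℕ} (p : (Fin n → ℂ) [×m]→L[ℂ] E) (z : Fin n → ℂ) :
    p (fun _ => z) = ∑ k ∈ Finset.piAntidiag Finset.univ m, (∏ i, z i ^ k i) • monomialCoeff p k := by
  have h1 : (fun _ : Fin m => z) = fun _ => ∑ i, z i • (Pi.single i 1 : Fin n → ℂ) := by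
    funext _
    simpa using (pi_eq_sum_univ' z)
  have h2 : p (fun _ => z) = ∑ f : Fin m → Fin n, (∏ j, z (f j)) • p fun j => Pi.single (f j) 1 := by
    rw [h1, ContinuousMultilinearMap.map_sum]
    exact Finset.sum_congr rfl fun f _ => p.map_smul_univ _ _
  rw [h2, ← Finset.sum_fiberwise_of_maps_to (t := Finset.piAntidiag Finset.univ m)
    (g := fun (f : Fin m → Fin n) i => (Finset.univ.filter fun j => f j = i).card)]
  · refine Finset.sum_congr rfl fun k _ => ?_
    rw [monomialCoeff, Finset.smul_sum]
    refine Finset.sum_congr rfl fun f hf => ?_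
    congr 1
    rw [Finset.mem_filter] at hf
    rw [← hf.2]
    calc ∏ j, z (f j) = ∏ i, ∏ j with f j = i, z (f j) :=
          (Finset.prod_fiberwise_of_maps_to (fun j _ => Finset.mem_univ (f j)) _).symm
      _ = _ := by
          refine Finset.prod_congr rfl fun i _ => ?_
          exact Finset.prod_eq_pow_card fun j hj => by rw [(Finset.mem_filter.1 hj).2]
  · intro f _
    rw [Finset.mem_piAntidiag]
    refine ⟨?_, fun i _ => Finset.mem_univ i⟩
    rw [← Finset.card_eq_sum_card_fiberwise fun j _ => Finset.mem_univ (f j)]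
    simp

end Homogeneous

/-! ### Bounded analytic functions belong to the Hardy space. -/

section BoundedAnalytic

variable {n : ℕ} {E : Type*} [NormedAddCommGroup E] [InnerProductSpace ℂ E]

lemma smul_mem_polydisc {w : Fin n → ℂ} (hw : ∀ i, ‖w i‖ ≤ 1) {l : ℂ}
    (hl : l ∈ Metric.ball (0 : ℂ) 1) : l • w ∈ polydisc n := by
  intro i
  rw [Pi.smul_apply, smul_eq_mul, norm_mul]
  exact (mul_le_of_le_one_right (norm_nonneg _) (hw i)).trans_lt (by simpa using hl)

lemma differentiableOn_slice {h : (Fin n → ℂ) → E} (hh : AnalyticOnNhd ℂ h (polydisc n))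
    {w : Fin n → ℂ} (hw : ∀ i, ‖w i‖ ≤ 1) :
    DifferentiableOn ℂ (fun l : ℂ => h (l • w)) (Metric.ball 0 1) := by
  intro l hl
  refine DifferentiableAt.differentiableWithinAt ?_
  exact DifferentiableAt.comp l (hh _ (smul_mem_polydisc hw hl)).differentiableAt (by fun_prop)

variable [CompleteSpace E]

/-- Composing the power series with the linear map l ↦ l w gives the power series of the slice,
whose coefficients are the normalized derivatives at 0. -/
lemma iteratedDeriv_slice {h : (Fin n → ℂ) → E} {p : FormalMultilinearSeries ℂ (Fin n → ℂ) E}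
    (hp : HasFPowerSeriesAt h p 0) (w : Fin n → ℂ) (m : ℕ) :
    ((m.factorial : ℂ)⁻¹ • iteratedDeriv m (fun l : ℂ => h (l • w)) 0) = p m fun _ => w := by
  set u : ℂ →L[ℂ] (Fin n → ℂ) := (ContinuousLinearMap.id ℂ ℂ).smulRight w with hu
  have h1 : HasFPowerSeriesAt (h ∘ u) (p.compContinuousLinearMap u) 0 := by
    apply HasFPowerSeriesAt.compContinuousLinearMap
    simpa using hp
  obtain ⟨r, hr⟩ := h1
  have h2 := hr.factorial_smul 1 m
  have h3 : (h ∘ u) = fun l : ℂ => h (l • w) := by ext l; simp [hu]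
  have h4 : (⇑u ∘ fun _ : Fin m => (1 : ℂ)) = fun _ => w := by ext; simp [hu]
  rw [h3, FormalMultilinearSeries.compContinuousLinearMap_apply, h4,
    ← Nat.cast_smul_eq_nsmul ℂ] at h2
  rw [iteratedDeriv_eq_iteratedFDeriv, ← h2, smul_smul, inv_mul_cancel₀, one_smul]
  exact_mod_cast m.factorial_ne_zero

/-- A bounded analytic Hilbert space valued function on the polydisc belongs to the Hardy space. -/
theorem exists_hardySpace_eval_eq {h : (Fin n → ℂ) → E} (hh : AnalyticOnNhd ℂ h (polydisc n))
    {C : ℝ} (hC : ∀ z ∈ polydisc n, ‖h z‖ ≤ C) :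
    ∃ a : HardySpace n E, ∀ z ∈ polydisc n, a.eval z = h z := by
  obtain ⟨p, hp⟩ := hh 0 (fun i => by simp)
  -- The series `p` is only known to converge near 0. Each slice is holomorphic on the whole unit
  -- disc, so the expansion into homogeneous parts holds on all of the polydisc.
  have hslice : ∀ {w : Fin n → ℂ}, (∀ i, ‖w i‖ ≤ 1) → ∀ {l : ℂ}, l ∈ Metric.ball (0 : ℂ) 1 →
      HasSum (fun m : ℕ => l ^ m • p m fun _ => w) (h (l • w)) := by
    intro w hw l hl
    have := hasSum_taylorCoeff (differentiableOn_slice hh hw) hl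
    simpa only [iteratedDeriv_slice hp] using this
  have hbound : ∀ {w : Fin n → ℂ}, (∀ i, ‖w i‖ ≤ 1) → ∀ m, ‖p m fun _ => w‖ ≤ C := by
    intro w hw m
    rw [← iteratedDeriv_slice hp]
    exact norm_taylorCoeff_le (differentiableOn_slice hh hw)
      (fun l hl => hC _ (smul_mem_polydisc hw hl)) m
  set a : (Fin n → ℕ) → E := fun k => monomialCoeff (p (∑ i, k i)) k with ha
  have hpa : ∀ m (z : Fin n → ℂ), p m (fun _ => z) =
      ∑ k ∈ Finset.piAntidiag Finset.univ m, (∏ i, z i ^ k i) • a k := by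
    intro m z
    rw [apply_diag_eq_sum_monomialCoeff]
    refine Finset.sum_congr rfl fun k hk => ?_
    obtain ⟨rfl, -⟩ := Finset.mem_piAntidiag.1 hk
    rfl
  -- The homogeneous part of degree |k| is bounded by C on the torus, so Parseval bounds each of its
  -- coefficients by C. The family `b` below consists of the coefficients of that degree, extended
  -- by 0.
  have haC : ∀ k, ‖a k‖ ≤ C := by
    intro k
    have hC0 : 0 ≤ C := (norm_nonneg _).trans (hC 0 fun i => by simp)
    set S := Finset.piAntidiag (Finset.univ : Finset (Fin n)) (∑ i, k i) with hS
    have hk : k ∈ S := by simp [hS]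
    set b : (Fin n → ℕ) → E := fun l => if l ∈ S then a l else 0 with hb
    have hbs : ∀ l ∉ S, b l = 0 := fun l hl => if_neg hl
    have hbsum : Summable fun l => ‖b l‖ :=
      summable_of_ne_finset_zero (s := S) fun l hl => by rw [hbs l hl, norm_zero]
    have hpar := integral_norm_sq_tsum
      (fun k => (continuous_torusMonomial (n := n) k).aestronglyMeasurable)
      norm_torusMonomial integral_conj_mul_torusMonomial hbsum (μ := torusMeasure n)
    rw [one_mul] at hpar
    have h1 : ‖a k‖ ^ 2 ≤ ∑' l, ‖b l‖ ^ 2 := by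
      have : Summable fun l => ‖b l‖ ^ 2 :=
        summable_of_ne_finset_zero (s := S) fun l hl => by rw [hbs l hl, norm_zero]; simp
      simpa [hb, hk] using this.le_tsum k fun _ _ => by positivity
    have h2 : ∀ t : UnitAddTorus (Fin n), ‖∑' l, torusMonomial l t • b l‖ ^ 2 ≤ C ^ 2 := by
      intro t
      have h3 : ∑' l, torusMonomial l t • b l =
          p (∑ i, k i) fun _ => fun i => (AddCircle.toCircle (t i) : ℂ) := by
        rw [hpa, tsum_eq_sum (s := S) fun l hl => by rw [hbs l hl, smul_zero]]
        refine Finset.sum_congr rfl fun l hl => ?_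
        rw [torusMonomial, show b l = a l from if_pos hl]
      rw [h3]
      gcongr
      exact hbound (fun i => by rw [Circle.norm_coe]) _
    have h3 : ∫ t, ‖∑' l, torusMonomial l t • b l‖ ^ 2 ∂torusMeasure n ≤ C ^ 2 := by
      calc _ ≤ ∫ _, C ^ 2 ∂torusMeasure n :=
            integral_mono_of_nonneg (.of_forall fun t => by positivity) (integrable_const _)
              (.of_forall h2)
        _ = C ^ 2 := by simp
    rw [hpar] at h3
    exact (sq_le_sq₀ (norm_nonneg _) hC0).1 (h1.trans h3)
  have hsumm : ∀ z ∈ polydisc n, Summable fun k : Fin n → ℕ => ‖(∏ i, z i ^ k i) • a k‖ := by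
    intro z hz
    refine Summable.of_nonneg_of_le (fun k => norm_nonneg _) (fun k => ?_)
      ((HardySpace.summable_monomial hz).mul_right C)
    rw [norm_smul]
    exact mul_le_mul_of_nonneg_left (haC k) (norm_nonneg _)
  have hsum : ∀ z ∈ polydisc n, ∑' k : Fin n → ℕ, (∏ i, z i ^ k i) • a k = h z := by
    -- Group the absolutely convergent monomial series by total degree. Writing z = r w with 0 < r <
    -- 1 and w in the closed polydisc identifies the result with the slice expansion at l = r.
    intro z hz
    have h1 := ((hsumm z hz).of_norm.hasSum).tsum_fiberwise fun k => ∑ i, k i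
    have h2 : ∀ m : ℕ, ∑' k : (fun k : Fin n → ℕ => ∑ i, k i) ⁻¹' {m},
        (∏ i, z i ^ (k : Fin n → ℕ) i) • a k = p m fun _ => z := by
      intro m
      have hset : (fun k : Fin n → ℕ => ∑ i, k i) ⁻¹' {m} =
          (Finset.piAntidiag (Finset.univ : Finset (Fin n)) m : Set (Fin n → ℕ)) := by
        ext k; simp
      rw [hset, Finset.tsum_subtype' (Finset.piAntidiag (Finset.univ : Finset (Fin n)) m)
        fun k : Fin n → ℕ => (∏ i, z i ^ k i) • a k, hpa]
    simp only [h2] at h1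
    obtain ⟨r, hr0, hr1, hrz⟩ : ∃ r : ℝ, 0 < r ∧ r < 1 ∧ ∀ i, ‖z i‖ ≤ r := by
      have hlt : ‖z‖ < 1 := (pi_norm_lt_iff one_pos).2 hz
      obtain ⟨r, hr, hr1⟩ := exists_between hlt
      exact ⟨r, (norm_nonneg _).trans_lt hr, hr1, fun i => (norm_le_pi_norm z i).trans hr.le⟩
    have hr' : (r : ℂ) ≠ 0 := by exact_mod_cast hr0.ne'
    set w : Fin n → ℂ := (r : ℂ)⁻¹ • z with hw
    have hzw : z = (r : ℂ) • w := by rw [hw, smul_smul, mul_inv_cancel₀ hr', one_smul]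
    have hw1 : ∀ i, ‖w i‖ ≤ 1 := by
      intro i
      rw [hw, Pi.smul_apply, smul_eq_mul, norm_mul, norm_inv, Complex.norm_real,
        Real.norm_of_nonneg hr0.le, inv_mul_le_iff₀ hr0, mul_one]
      exact hrz i
    have h3 := hslice hw1 (l := r) (by simpa [abs_of_pos hr0] using hr1)
    have h4 : ∀ m, p m (fun _ => z) = (r : ℂ) ^ m • p m fun _ => w := by
      intro m
      have := (p m).map_smul_univ (fun _ => (r : ℂ)) fun _ => w
      rw [hzw]
      simpa using this
    simp only [h4] at h1
    rw [h1.unique h3, ← hzw]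
  -- Parseval on the torus of radius r bounds the dilated square sums by C²; on finite sets r may
  -- then tend to 1.
  have hsq : Summable fun k => ‖a k‖ ^ 2 := by
    refine summable_of_sum_le (c := C ^ 2) (fun k => by positivity) fun s => ?_
    refine sum_norm_sq_le_of_dilates (d := fun k : Fin n → ℕ => ∑ i, k i) fun r hr => ?_
    have hsr : Summable fun k : Fin n → ℕ => ‖(r : ℂ) ^ (∑ i, k i) • a k‖ := by
      have := hsumm _ (dilate_mem_polydisc hr.1 hr.2 0)
      simpa only [prod_dilate_pow, norm_smul, norm_mul, norm_torusMonomial, mul_one] using this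
    have hpar := integral_norm_sq_tsum
      (fun k => (continuous_torusMonomial (n := n) k).aestronglyMeasurable)
      norm_torusMonomial integral_conj_mul_torusMonomial hsr (μ := torusMeasure n)
    rw [one_mul] at hpar
    have h1 : ∀ t : UnitAddTorus (Fin n),
        ∑' k, torusMonomial k t • ((r : ℂ) ^ (∑ i, k i) • a k) = h (dilate r t) := by
      intro t
      rw [← hsum _ (dilate_mem_polydisc hr.1 hr.2 t)]
      refine tsum_congr fun k => ?_
      rw [prod_dilate_pow, smul_smul, mul_comm]
    simp only [h1] at hpar
    have hsr2 : Summable fun k : Fin n → ℕ => ‖(r : ℂ) ^ (∑ i, k i) • a k‖ ^ 2 :=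
      summable_sq_of_summable (fun _ => norm_nonneg _) hsr
    refine (hsr2.sum_le_tsum s fun _ _ => by positivity).trans ?_
    rw [← hpar]
    calc _ ≤ ∫ _, C ^ 2 ∂torusMeasure n :=
          integral_mono_of_nonneg (.of_forall fun t => by positivity) (integrable_const _)
            (.of_forall fun t => by
              dsimp only
              gcongr
              exact hC _ (dilate_mem_polydisc hr.1 hr.2 t))
      _ = C ^ 2 := by simp
  refine ⟨⟨a, memℓp_gen (by simpa using hsq)⟩, fun z hz => ?_⟩
  rw [HardySpace.eval, ← hsum z hz]

end BoundedAnalytic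

/-! ### A boundary function on the circle along a sequence of radii. -/

section CircleBoundary

variable {E : Type*} [NormedAddCommGroup E] [InnerProductSpace ℂ E]

lemma circleMap_mem_ball {r : ℝ} (hr : r ∈ Set.Ioo (0 : ℝ) 1) (θ : ℝ) :
    circleMap 0 r θ ∈ Metric.ball (0 : ℂ) 1 := by
  simpa [norm_circleMap_zero, abs_of_pos hr.1] using hr.2

lemma continuous_comp_circleMap {f : ℂ → E} (hf : DifferentiableOn ℂ f (Metric.ball 0 1)) {r : ℝ}
    (hr : r ∈ Set.Ioo (0 : ℝ) 1) : Continuous fun θ : ℝ => f (circleMap 0 r θ) :=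
  hf.continuousOn.comp_continuous (continuous_circleMap 0 r) (circleMap_mem_ball hr)

lemma integral_conj_mul_exp (k l : ℕ) :
    ∫ θ : ℝ, conj (Complex.exp (θ * Complex.I) ^ k) * Complex.exp (θ * Complex.I) ^ l
      ∂volume.restrict (Set.Ioc 0 (2 * Real.pi)) = if k = l then ((2 * Real.pi : ℝ) : ℂ) else 0 := by
  have h : ∀ θ : ℝ, conj (Complex.exp (θ * Complex.I) ^ k) * Complex.exp (θ * Complex.I) ^ l =
      Complex.exp ((((l : ℂ) - k) * Complex.I) * θ) := by
    intro θ
    rw [← Complex.exp_nat_mul, ← Complex.exp_conj, ← Complex.exp_nat_mul, ← Complex.exp_add]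
    congr 1
    simp only [map_mul, Complex.conj_ofReal, Complex.conj_I, map_natCast]
    ring
  simp_rw [h]
  rw [← intervalIntegral.integral_of_le (by positivity)]
  by_cases hkl : k = l
  · simp [hkl]
  · have hne : ((l : ℂ) - k) ≠ 0 := by
      rw [sub_ne_zero]
      exact_mod_cast Ne.symm hkl
    rw [if_neg hkl, integral_exp_mul_complex (mul_ne_zero hne Complex.I_ne_zero)]
    have : Complex.exp (((l : ℂ) - k) * Complex.I * ((2 * Real.pi : ℝ) : ℂ)) = 1 := by
      rw [Complex.exp_eq_one_iff]
      exact ⟨(l : ℤ) - k, by push_cast; ring⟩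
    rw [this, Complex.ofReal_zero, mul_zero, Complex.exp_zero, sub_self, zero_div]

lemma Lp_norm_sq_eq_integral {X : Type*} [MeasurableSpace X] {μ : Measure X} (h : Lp E 2 μ) :
    ‖h‖ ^ 2 = ∫ x, ‖h x‖ ^ 2 ∂μ := by
  have h1 := L2.inner_def (𝕜 := ℂ) h h
  simp only [inner_self_eq_norm_sq_to_K] at h1
  apply Complex.ofReal_injective
  rw [← integral_complex_ofReal]
  push_cast
  exact h1

variable [CompleteSpace E]

/-- A bounded holomorphic function on the disc has almost everywhere a boundary limit along some
sequence of radii. -/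
theorem exists_seq_tendsto_boundary {f : ℂ → E} {C : ℝ}
    (hf : DifferentiableOn ℂ f (Metric.ball 0 1)) (hC : ∀ z ∈ Metric.ball (0 : ℂ) 1, ‖f z‖ ≤ C) :
    ∃ (ρ : ℕ → ℝ) (G : ℝ → E), (∀ j, ρ j ∈ Set.Ioo (0 : ℝ) 1) ∧ Tendsto ρ atTop (𝓝 1) ∧
      AEStronglyMeasurable G (volume.restrict (Set.Ioc 0 (2 * Real.pi))) ∧
      ∀ᵐ θ ∂volume.restrict (Set.Ioc 0 (2 * Real.pi)),
        Tendsto (fun j => f (circleMap 0 (ρ j) θ)) atTop (𝓝 (G θ)) := by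
  set μ : Measure ℝ := volume.restrict (Set.Ioc 0 (2 * Real.pi)) with hμ
  set c : ℕ → E := fun m => (m.factorial : ℂ)⁻¹ • iteratedDeriv m f 0 with hc
  set e : ℕ → ℝ → ℂ := fun m θ => Complex.exp (θ * Complex.I) ^ m with he
  have hem : ∀ m, AEStronglyMeasurable (e m) μ := fun m =>
    Continuous.aestronglyMeasurable (by fun_prop)
  have hen : ∀ m θ, ‖e m θ‖ = 1 := fun m θ => by
    simp [he, Complex.norm_exp_ofReal_mul_I]
  have hcC : ∀ m, ‖c m‖ ≤ C := norm_taylorCoeff_le hf hC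
  have hcr : ∀ r ∈ Set.Ioo (0 : ℝ) 1, Summable fun m : ℕ => ‖(r : ℂ) ^ m • c m‖ := by
    intro r hr
    refine Summable.of_nonneg_of_le (fun m => norm_nonneg _) (fun m => ?_)
      ((summable_geometric_of_lt_one hr.1.le hr.2).mul_right C)
    rw [norm_smul, norm_pow, Complex.norm_real, Real.norm_of_nonneg hr.1.le]
    exact mul_le_mul_of_nonneg_left (hcC m) (pow_nonneg hr.1.le _)
  have hfr : ∀ r ∈ Set.Ioo (0 : ℝ) 1, ∀ θ : ℝ,
      HasSum (fun m => e m θ • (r : ℂ) ^ m • c m) (f (circleMap 0 r θ)) := by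
    intro r hr θ
    have := hasSum_taylorCoeff hf (circleMap_mem_ball hr θ)
    convert this using 2 with m
    rw [circleMap_zero, mul_pow, smul_smul, mul_comm]
  have hsq : Summable fun m => ‖c m‖ ^ 2 := by
    refine summable_of_sum_le (c := C ^ 2) (fun k => by positivity) fun s => ?_
    refine sum_norm_sq_le_of_dilates (d := fun m => m) fun r hr => ?_
    have hpar := integral_norm_sq_tsum hem hen integral_conj_mul_exp (hcr r hr)
    simp only [(hfr r hr _).tsum_eq] at hpar
    refine ((summable_sq_of_summable (fun _ => norm_nonneg _) (hcr r hr)).sum_le_tsum s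
      fun _ _ => by positivity).trans ?_
    have h1 : ∫ θ, ‖f (circleMap 0 r θ)‖ ^ 2 ∂μ ≤ ∫ _, C ^ 2 ∂μ :=
      integral_mono_of_nonneg (.of_forall fun t => by positivity) (integrable_const _)
        (.of_forall fun t => by
          dsimp only
          gcongr
          exact hC _ (circleMap_mem_ball hr t))
    rw [hpar, integral_const, hμ] at h1
    simp only [measureReal_restrict_apply_univ, Real.volume_real_Ioc, sub_zero, smul_eq_mul] at h1
    rw [max_eq_left (by positivity)] at h1
    exact le_of_mul_le_mul_left h1 (by positivity)
  -- The shift by 2 keeps the first radius positive.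
  set ρ : ℕ → ℝ := fun j => 1 - 1 / ((j : ℝ) + 2) with hρ
  have hρ01 : ∀ j, ρ j ∈ Set.Ioo (0 : ℝ) 1 := by
    intro j
    have h1 : (0 : ℝ) < 1 / ((j : ℝ) + 2) := by positivity
    have h2 : 1 / ((j : ℝ) + 2) < 1 := by
      rw [div_lt_one (by positivity)]
      have : (0 : ℝ) ≤ j := by positivity
      linarith
    exact ⟨by simp only [hρ]; linarith, by simp only [hρ]; linarith⟩
  have hρlim : Tendsto ρ atTop (𝓝 1) := by
    have h1 : Tendsto (fun j : ℕ => 1 / ((j : ℝ) + 2)) atTop (𝓝 0) := by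
      refine tendsto_const_nhds.div_atTop ?_
      exact tendsto_atTop_add_const_right _ _ tendsto_natCast_atTop_atTop
    simpa only [sub_zero] using tendsto_const_nhds.sub h1
  have hmem : ∀ j, MemLp (fun θ : ℝ => f (circleMap 0 (ρ j) θ)) 2 μ := fun j =>
    MemLp.of_bound (continuous_comp_circleMap hf (hρ01 j)).aestronglyMeasurable C
      (.of_forall fun θ => hC _ (circleMap_mem_ball (hρ01 j) θ))
  set g : ℕ → Lp E 2 μ := fun j => (hmem j).toLp with hg
  -- Parseval turns the L² distance of two dilations into a weighted square sum of Taylor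
  -- coefficients. It is dominated by 4 ∑ ‖c m‖² and tends to 0 termwise, so the dilations form a
  -- Cauchy sequence.
  have hdist : ∀ p : ℕ × ℕ, dist (g p.1) (g p.2) =
      √(2 * Real.pi * ∑' m, ‖((ρ p.1 : ℂ) ^ m - (ρ p.2 : ℂ) ^ m) • c m‖ ^ 2) := by
    intro p
    have hs : Summable fun m => ‖((ρ p.1 : ℂ) ^ m - (ρ p.2 : ℂ) ^ m) • c m‖ := by
      refine Summable.of_nonneg_of_le (fun m => norm_nonneg _) (fun m => ?_)
        ((hcr _ (hρ01 p.1)).add (hcr _ (hρ01 p.2)))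
      rw [sub_smul]
      exact norm_sub_le _ _
    rw [← integral_norm_sq_tsum hem hen integral_conj_mul_exp hs, ← Real.sqrt_sq dist_nonneg,
      dist_eq_norm, Lp_norm_sq_eq_integral]
    congr 1
    refine integral_congr_ae ?_
    filter_upwards [Lp.coeFn_sub (g p.1) (g p.2), (hmem p.1).coeFn_toLp, (hmem p.2).coeFn_toLp]
      with θ h1 h2 h3
    rw [h1, Pi.sub_apply, h2, h3,
      ← ((hfr _ (hρ01 p.1) θ).sub (hfr _ (hρ01 p.2) θ)).tsum_eq]
    simp only [sub_smul, smul_sub]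
  have hcauchy : CauchySeq g := by
    rw [cauchySeq_iff_tendsto_dist_atTop_0]
    simp_rw [hdist]
    have h0 : Tendsto (fun p : ℕ × ℕ =>
        ∑' m, ‖((ρ p.1 : ℂ) ^ m - (ρ p.2 : ℂ) ^ m) • c m‖ ^ 2) atTop (𝓝 (∑' m : ℕ, 0)) := by
      refine tendsto_tsum_of_dominated_convergence (hsq.mul_left 4) (fun m => ?_) ?_
      · have h1 : Tendsto (fun p : ℕ × ℕ => (ρ p.1, ρ p.2)) atTop (𝓝 (1, 1)) := by
          rw [← prod_atTop_atTop_eq, nhds_prod_eq]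
          exact hρlim.prodMap hρlim
        have h2 : Continuous fun x : ℝ × ℝ => ‖((x.1 : ℂ) ^ m - (x.2 : ℂ) ^ m) • c m‖ ^ 2 := by
          fun_prop
        simpa [Function.comp_def] using (h2.tendsto (1, 1)).comp h1
      · refine .of_forall fun p m => ?_
        rw [Real.norm_of_nonneg (by positivity), norm_smul, mul_pow]
        refine mul_le_mul_of_nonneg_right ?_ (by positivity)
        have h1 : ∀ j, ‖(ρ j : ℂ) ^ m‖ ≤ 1 := fun j => by
          rw [norm_pow, Complex.norm_real, Real.norm_of_nonneg (hρ01 j).1.le]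
          exact pow_le_one₀ (hρ01 j).1.le (hρ01 j).2.le
        calc ‖(ρ p.1 : ℂ) ^ m - (ρ p.2 : ℂ) ^ m‖ ^ 2 ≤ (1 + 1) ^ 2 := by
              gcongr
              exact (norm_sub_le _ _).trans (add_le_add (h1 _) (h1 _))
          _ = 4 := by norm_num
    have h3 := (Real.continuous_sqrt.tendsto _).comp (h0.const_mul (2 * Real.pi))
    simpa [Function.comp_def] using h3
  obtain ⟨G, hG⟩ := cauchySeq_tendsto_of_complete hcauchy
  -- L² convergence gives convergence in measure, hence almost everywhere along a subsequence.
  obtain ⟨ns, hns, hlim⟩ := (tendstoInMeasure_of_tendsto_Lp hG).exists_seq_tendsto_ae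
  refine ⟨ρ ∘ ns, G, fun j => hρ01 _, hρlim.comp hns.tendsto_atTop, Lp.aestronglyMeasurable G, ?_⟩
  have hall : ∀ᵐ θ ∂μ, ∀ j, g j θ = f (circleMap 0 (ρ j) θ) :=
    ae_all_iff.2 fun j => (hmem j).coeFn_toLp
  filter_upwards [hlim, hall] with θ h1 h2
  simpa only [h2, Function.comp_apply] using h1

end CircleBoundary

/-! ### The Poisson kernel, its derivative, and the Poisson integral by parts. -/

section PoissonKernel

/-- The Poisson kernel of the unit disc in angular coordinates. -/
noncomputable def angularPoisson (r u : ℝ) : ℝ := (1 - r ^ 2) / (1 - 2 * r * Real.cos u + r ^ 2)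

/-- The angular derivative of the Poisson kernel. -/
noncomputable def angularPoissonDeriv (r u : ℝ) : ℝ :=
  -((1 - r ^ 2) * (2 * r * Real.sin u)) / (1 - 2 * r * Real.cos u + r ^ 2) ^ 2

lemma angularPoisson_denom_pos {r : ℝ} (hr : r ∈ Set.Ioo (0 : ℝ) 1) (u : ℝ) :
    0 < 1 - 2 * r * Real.cos u + r ^ 2 := by
  have h1 := Real.cos_le_one u
  nlinarith [hr.1, hr.2, sq_nonneg (1 - r), mul_nonneg hr.1.le (sub_nonneg.2 h1),
    mul_pos (sub_pos.2 hr.2) (sub_pos.2 hr.2)]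

lemma hasDerivAt_angularPoisson {r : ℝ} (hr : r ∈ Set.Ioo (0 : ℝ) 1) (u : ℝ) :
    HasDerivAt (angularPoisson r) (angularPoissonDeriv r u) u := by
  have h1 : HasDerivAt (fun u => 1 - 2 * r * Real.cos u + r ^ 2) (2 * r * Real.sin u) u := by
    refine ((((Real.hasDerivAt_cos u).const_mul (2 * r)).const_sub 1).add_const
      (r ^ 2)).congr_deriv ?_
    ring
  refine ((hasDerivAt_const u (1 - r ^ 2)).fun_div h1
    (angularPoisson_denom_pos hr u).ne').congr_deriv ?_
  rw [angularPoissonDeriv]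
  ring

lemma continuous_angularPoisson {r : ℝ} (hr : r ∈ Set.Ioo (0 : ℝ) 1) :
    Continuous (angularPoisson r) :=
  continuous_iff_continuousAt.2 fun u => (hasDerivAt_angularPoisson hr u).continuousAt

lemma continuous_angularPoissonDeriv {r : ℝ} (hr : r ∈ Set.Ioo (0 : ℝ) 1) :
    Continuous (angularPoissonDeriv r) := by
  unfold angularPoissonDeriv
  refine Continuous.div (by fun_prop) (by fun_prop) fun u => ?_
  exact pow_ne_zero _ (angularPoisson_denom_pos hr u).ne'

lemma angularPoisson_nonneg {r : ℝ} (hr : r ∈ Set.Ioo (0 : ℝ) 1) (u : ℝ) :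
    0 ≤ angularPoisson r u :=
  div_nonneg (by nlinarith [hr.1, hr.2]) (angularPoisson_denom_pos hr u).le

/-- In half angles this is u/2 ≤ tan (u/2), since 1 - cos u = 2 sin² (u/2). -/
lemma mul_sin_le {u : ℝ} (h0 : 0 ≤ u) (h1 : u ≤ 1) : u * Real.sin u ≤ 2 * (1 - Real.cos u) := by
  have hpi := Real.pi_gt_three
  have hs : 0 ≤ Real.sin (u / 2) := Real.sin_nonneg_of_nonneg_of_le_pi (by linarith) (by linarith)
  have hc : 0 < Real.cos (u / 2) := Real.cos_pos_of_mem_Ioo ⟨by linarith, by linarith⟩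
  have ht := Real.le_tan (x := u / 2) (by linarith) (by linarith)
  rw [Real.tan_eq_sin_div_cos, le_div_iff₀ hc] at ht
  have h2 : Real.sin u = 2 * Real.sin (u / 2) * Real.cos (u / 2) := by
    rw [← Real.sin_two_mul]; ring_nf
  have h3 : 1 - Real.cos u = 2 * Real.sin (u / 2) ^ 2 := by
    have := Real.cos_two_mul' (u / 2)
    rw [show 2 * (u / 2) = u by ring] at this
    nlinarith [Real.sin_sq_add_cos_sq (u / 2)]
  rw [h2, h3]
  nlinarith

lemma abs_mul_abs_sin_le {u : ℝ} (hu : |u| ≤ 1) : |u| * |Real.sin u| ≤ 2 * (1 - Real.cos u) := by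
  have h1 := mul_sin_le (abs_nonneg u) hu
  have h2 : |Real.sin u| = Real.sin |u| := by
    rcases abs_cases u with ⟨h, h'⟩ | ⟨h, h'⟩
    · rw [h, abs_of_nonneg]
      exact Real.sin_nonneg_of_nonneg_of_le_pi h' (by linarith [Real.pi_gt_three])
    · rw [h, Real.sin_neg, abs_of_nonpos]
      exact Real.sin_nonpos_of_nonpos_of_neg_pi_le h'.le (by linarith [Real.pi_gt_three])
  rwa [h2, ← Real.cos_abs u]

lemma abs_angularPoissonDeriv_eq {r : ℝ} (hr : r ∈ Set.Ioo (0 : ℝ) 1) (u : ℝ) :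
    |angularPoissonDeriv r u| =
      (1 - r ^ 2) * (2 * r * |Real.sin u|) / (1 - 2 * r * Real.cos u + r ^ 2) ^ 2 := by
  have h1 : 0 ≤ 1 - r ^ 2 := by nlinarith [hr.1, hr.2]
  rw [angularPoissonDeriv, abs_div, abs_neg, abs_mul, abs_mul, abs_mul, abs_of_nonneg h1,
    abs_of_pos hr.1, abs_pow, abs_of_pos (angularPoisson_denom_pos hr u), abs_two]

/-- Near its peak, the derivative of the Poisson kernel is controlled by the kernel itself. -/
lemma abs_angularPoissonDeriv_mul_le {r : ℝ} (hr : r ∈ Set.Ioo (0 : ℝ) 1) {u : ℝ} (hu : |u| ≤ 1) :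
    |angularPoissonDeriv r u| * |u| ≤ 2 * angularPoisson r u := by
  have hD := angularPoisson_denom_pos hr u
  have h1 : 0 ≤ 1 - r ^ 2 := by nlinarith [hr.1, hr.2]
  have h2 := abs_mul_abs_sin_le hu
  rw [abs_angularPoissonDeriv_eq hr, angularPoisson, div_mul_eq_mul_div, ← mul_div_assoc,
    div_le_div_iff₀ (by positivity) hD]
  -- The denominator equals (1 - r)² + 2r(1 - cos u), hence is at least 2r(1 - cos u).
  have h3 : 2 * r * (|u| * |Real.sin u|) ≤ 2 * (1 - 2 * r * Real.cos u + r ^ 2) := by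
    nlinarith [mul_le_mul_of_nonneg_left h2 hr.1.le, sq_nonneg (1 - r)]
  calc (1 - r ^ 2) * (2 * r * |Real.sin u|) * |u| * (1 - 2 * r * Real.cos u + r ^ 2)
      = (1 - r ^ 2) * (1 - 2 * r * Real.cos u + r ^ 2) * (2 * r * (|u| * |Real.sin u|)) := by ring
    _ ≤ (1 - r ^ 2) * (1 - 2 * r * Real.cos u + r ^ 2) *
        (2 * (1 - 2 * r * Real.cos u + r ^ 2)) := by gcongr
    _ = _ := by ring

/-- Away from its peak, the derivative of the Poisson kernel is small. -/
lemma abs_angularPoissonDeriv_le {r : ℝ} (hr : r ∈ Set.Ico (1 / 2 : ℝ) 1) {u m : ℝ} (hm : 0 < m)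
    (hu : m ≤ 1 - Real.cos u) : |angularPoissonDeriv r u| ≤ (1 - r ^ 2) * (2 / m ^ 2) := by
  have hr' : r ∈ Set.Ioo (0 : ℝ) 1 := ⟨by linarith [hr.1], hr.2⟩
  have h1 : 0 ≤ 1 - r ^ 2 := by nlinarith [hr'.1, hr.2]
  -- The denominator is at least 2r(1 - cos u) ≥ 2rm, and r ≥ 1/2.
  have h2 : m ≤ 1 - 2 * r * Real.cos u + r ^ 2 := by
    nlinarith [mul_le_mul_of_nonneg_left hu hr'.1.le, sq_nonneg (1 - r), hr.1]
  rw [abs_angularPoissonDeriv_eq hr', mul_div_assoc]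
  refine mul_le_mul_of_nonneg_left ?_ h1
  gcongr
  nlinarith [Real.abs_sin_le_one u, abs_nonneg (Real.sin u), hr'.1, hr'.2]

lemma poissonKernel_circleMap {r : ℝ} (θ s : ℝ) :
    (‖circleMap 0 1 s - 0‖ ^ 2 - ‖circleMap 0 r θ - 0‖ ^ 2) /
      ‖circleMap 0 1 s - 0 - (circleMap 0 r θ - 0)‖ ^ 2 = angularPoisson r (s - θ) := by
  simp only [sub_zero, norm_circleMap_zero, sq_abs, angularPoisson, one_pow]
  congr 1
  rw [← Complex.normSq_eq_norm_sq, Complex.normSq_apply]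
  simp only [circleMap_zero, Complex.ofReal_one, one_mul, Complex.sub_re, Complex.sub_im,
    Complex.exp_ofReal_mul_I_re, Complex.exp_ofReal_mul_I_im, Complex.re_ofReal_mul,
    Complex.im_ofReal_mul, Real.cos_sub]
  nlinarith [Real.sin_sq_add_cos_sq s, Real.sin_sq_add_cos_sq θ]

variable {E : Type*} [NormedAddCommGroup E] [InnerProductSpace ℂ E] [CompleteSpace E]

lemma integral_angularPoisson_smul {g : ℂ → E} (hg : DiffContOnCl ℂ g (Metric.ball 0 1)) {r : ℝ}
    (hr : r ∈ Set.Ioo (0 : ℝ) 1) (θ : ℝ) :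
    ∫ s in 0..2 * Real.pi, angularPoisson r (s - θ) • g (circleMap 0 1 s) =
      (2 * Real.pi) • g (circleMap 0 r θ) := by
  have h := hg.circleAverage_poissonKernel_smul' (circleMap_mem_ball hr θ)
  rw [Real.circleAverage_def] at h
  simp only [poissonKernel_circleMap] at h
  rw [← h, smul_smul, mul_inv_cancel₀ (by positivity), one_smul]

lemma integral_angularPoisson {r : ℝ} (hr : r ∈ Set.Ioo (0 : ℝ) 1) (θ : ℝ) :
    ∫ s in 0..2 * Real.pi, angularPoisson r (s - θ) = 2 * Real.pi := by
  have h := integral_angularPoisson_smul (g := fun _ => (1 : ℂ)) diffContOnCl_const hr θ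
  simp only [Complex.real_smul, mul_one] at h
  rw [intervalIntegral.integral_ofReal] at h
  exact_mod_cast h

/-- The Poisson integral, integrated by parts. -/
lemma integral_angularPoisson_smul_sub {f : ℂ → E} (hf : DifferentiableOn ℂ f (Metric.ball 0 1))
    (A : E) {r ρ : ℝ} (hr : r ∈ Set.Ioo (0 : ℝ) 1) (hρ : ρ ∈ Set.Ioo (0 : ℝ) 1) (θ : ℝ) :
    (2 * Real.pi) • (f (ρ * circleMap 0 r θ) - A) =
      angularPoisson r (2 * Real.pi - θ) •
        (∫ u in θ..2 * Real.pi, (f (circleMap 0 ρ u) - A)) -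
      angularPoisson r (0 - θ) • (∫ u in θ..0, (f (circleMap 0 ρ u) - A)) -
      ∫ s in 0..2 * Real.pi, angularPoissonDeriv r (s - θ) •
        ∫ u in θ..s, (f (circleMap 0 ρ u) - A) := by
  have hρz : ∀ z ∈ Metric.closedBall (0 : ℂ) 1, (ρ : ℂ) * z ∈ Metric.ball (0 : ℂ) 1 := by
    intro z hz
    rw [mem_closedBall_zero_iff] at hz
    rw [mem_ball_zero_iff, norm_mul, Complex.norm_real, Real.norm_of_nonneg hρ.1.le]
    exact (mul_le_of_le_one_right hρ.1.le hz).trans_lt hρ.2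
  -- After dilation by ρ the function is continuous up to the unit circle, so the Poisson formula
  -- applies to it.
  have hg : DiffContOnCl ℂ (fun z => f (ρ * z) - A) (Metric.ball 0 1) := by
    refine DifferentiableOn.diffContOnCl_ball (U := Metric.closedBall 0 1) ?_ subset_rfl
    refine DifferentiableOn.sub_const ?_ A
    exact hf.comp (by fun_prop) hρz
  have hcirc : ∀ s, (ρ : ℂ) * circleMap 0 1 s = circleMap 0 ρ s := by
    intro s; simp [circleMap_zero]
  have hcont : Continuous fun u : ℝ => f (circleMap 0 ρ u) - A :=
    (continuous_comp_circleMap hf hρ).sub continuous_const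
  have h1 := integral_angularPoisson_smul hg hr θ
  simp only [hcirc] at h1
  rw [← h1]
  refine intervalIntegral.integral_smul_deriv_eq_deriv_smul
    (u := fun s => angularPoisson r (s - θ)) (u' := fun s => angularPoissonDeriv r (s - θ))
    (v := fun s => ∫ u in θ..s, (f (circleMap 0 ρ u) - A)) (fun s _ => ?_) (fun s _ => ?_) ?_ ?_
  · exact (hasDerivAt_angularPoisson hr (s - θ)).comp_sub_const s θ
  · exact hcont.integral_hasStrictDerivAt θ s |>.hasDerivAt
  · exact ((continuous_angularPoissonDeriv hr).comp (continuous_id.sub continuous_const)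
      ).intervalIntegrable _ _
  · exact hcont.intervalIntegrable _ _

end PoissonKernel

/-! ### Fatou's theorem on the disc. -/

section DiscFatou

variable {E : Type*} [NormedAddCommGroup E] [InnerProductSpace ℂ E]

lemma cos_sub_lt_one {θ s : ℝ} (hθ : θ ∈ Set.Ioo 0 (2 * Real.pi))
    (hs : s ∈ Set.Icc 0 (2 * Real.pi)) (h : s ≠ θ) : 0 < 1 - Real.cos (s - θ) := by
  refine sub_pos.2 (lt_of_le_of_ne (Real.cos_le_one _) fun hc => h ?_)
  rw [Real.cos_eq_one_iff_of_lt_of_lt (by linarith [hs.1, hθ.2]) (by linarith [hs.2, hθ.1])] at hc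
  linarith

lemma tendsto_one_sub_sq : Tendsto (fun r : ℝ => 1 - r ^ 2) (𝓝[<] 1) (𝓝 0) := by
  have : Continuous fun r : ℝ => 1 - r ^ 2 := by fun_prop
  simpa using (this.tendsto 1).mono_left nhdsWithin_le_nhds

lemma tendsto_angularPoisson_zero {θ s : ℝ} (hθ : θ ∈ Set.Ioo 0 (2 * Real.pi))
    (hs : s ∈ Set.Icc 0 (2 * Real.pi)) (h : s ≠ θ) :
    Tendsto (fun r => angularPoisson r (s - θ)) (𝓝[<] 1) (𝓝 0) := by
  have h0 := cos_sub_lt_one hθ hs h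
  have : ContinuousAt (fun r => angularPoisson r (s - θ)) 1 := by
    unfold angularPoisson
    refine ContinuousAt.div (by fun_prop) (by fun_prop) ?_
    have : 0 < 1 - 2 * 1 * Real.cos (s - θ) + 1 ^ 2 := by linarith
    exact this.ne'
  simpa [angularPoisson] using this.tendsto.mono_left nhdsWithin_le_nhds

/-- Integrals against the derivative of the Poisson kernel of a function that vanishes to order
greater than one at the peak tend to zero. -/
lemma tendsto_integral_angularPoissonDeriv {θ B : ℝ} {Ψ : ℝ → E}
    (hθ : θ ∈ Set.Ioo 0 (2 * Real.pi)) (hΨ : HasDerivAt Ψ 0 θ) (hΨ0 : Ψ θ = 0)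
    (hB : ∀ s ∈ Set.Icc 0 (2 * Real.pi), ‖Ψ s‖ ≤ B) :
    Tendsto (fun r => ∫ s in 0..2 * Real.pi, angularPoissonDeriv r (s - θ) • Ψ s)
      (𝓝[<] 1) (𝓝 0) := by
  have hpi := Real.pi_pos
  have hB0 : 0 ≤ B := (norm_nonneg _).trans (hB θ ⟨hθ.1.le, hθ.2.le⟩)
  rw [Metric.tendsto_nhds]
  intro η hη
  -- Near the peak the integrand is at most 2ε times the Poisson kernel, whose integral is 2π; this
  -- choice makes that contribution η/2.
  set ε : ℝ := η / (8 * Real.pi) with hε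
  have hε0 : 0 < ε := by positivity
  obtain ⟨δ, hδ0, hδ1, hδ⟩ : ∃ δ : ℝ, 0 < δ ∧ δ ≤ 1 ∧ ∀ s, |s - θ| < δ → ‖Ψ s‖ ≤ ε * |s - θ| := by
    have h1 := hΨ.isLittleO.def hε0
    obtain ⟨δ, hδ, h2⟩ := Metric.eventually_nhds_iff.1 h1
    refine ⟨min δ 1, by positivity, min_le_right _ _, fun s hs => ?_⟩
    have := h2 (y := s) (by rw [Real.dist_eq]; exact hs.trans_le (min_le_left _ _))
    simpa [hΨ0] using this
  -- Since θ is interior to the period, 1 - cos(s - θ) vanishes on [0, 2π] only at s = θ, so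
  -- compactness bounds it below off a neighbourhood of θ.
  obtain ⟨m, hm0, hm⟩ : ∃ m : ℝ, 0 < m ∧ ∀ s ∈ Set.Icc 0 (2 * Real.pi) ∩ {s | δ ≤ |s - θ|},
      m ≤ 1 - Real.cos (s - θ) := by
    refine IsCompact.exists_forall_le' (f := fun s => 1 - Real.cos (s - θ))
      (isCompact_Icc.inter_right ?_) (by fun_prop) ?_
    · exact isClosed_le continuous_const (by fun_prop)
    · rintro s ⟨hs, hs'⟩
      refine cos_sub_lt_one hθ hs fun h => ?_
      simp only [Set.mem_ofPred_eq, h, sub_self, abs_zero] at hs'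
      linarith
  have hsmall : ∀ᶠ r in 𝓝[<] (1 : ℝ), (1 - r ^ 2) * (2 / m ^ 2) * B * (2 * Real.pi) < η / 2 := by
    have h1 := ((tendsto_one_sub_sq.mul_const (2 / m ^ 2)).mul_const B).mul_const (2 * Real.pi)
    simp only [zero_mul] at h1
    exact h1.eventually_lt_const (by positivity)
  filter_upwards [hsmall, Ico_mem_nhdsLT (show (1 / 2 : ℝ) < 1 by norm_num)] with r hr1 hr2
  have hr : r ∈ Set.Ioo (0 : ℝ) 1 := ⟨by linarith [hr2.1], hr2.2⟩
  have hr3 : 0 ≤ 1 - r ^ 2 := by nlinarith [hr.1, hr.2]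
  rw [dist_zero_right]
  have hPc : Continuous fun s => angularPoisson r (s - θ) :=
    (continuous_angularPoisson hr).comp (continuous_id.sub continuous_const)
  have hbound : ‖∫ s in 0..2 * Real.pi, angularPoissonDeriv r (s - θ) • Ψ s‖ ≤
      ∫ s in 0..2 * Real.pi,
        (2 * ε * angularPoisson r (s - θ) + (1 - r ^ 2) * (2 / m ^ 2) * B) := by
    refine intervalIntegral.norm_integral_le_of_norm_le (by positivity) (.of_forall fun s hs => ?_)
      (Continuous.intervalIntegrable (by fun_prop) _ _)
    have hP := angularPoisson_nonneg hr (s - θ)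
    have hs' : s ∈ Set.Icc 0 (2 * Real.pi) := ⟨hs.1.le, hs.2⟩
    rw [norm_smul, Real.norm_eq_abs]
    rcases lt_or_ge |s - θ| δ with h | h
    · calc |angularPoissonDeriv r (s - θ)| * ‖Ψ s‖
          ≤ |angularPoissonDeriv r (s - θ)| * (ε * |s - θ|) := by gcongr; exact hδ s h
        _ = ε * (|angularPoissonDeriv r (s - θ)| * |s - θ|) := by ring
        _ ≤ ε * (2 * angularPoisson r (s - θ)) := by
            exact mul_le_mul_of_nonneg_left
              (abs_angularPoissonDeriv_mul_le hr (h.le.trans hδ1)) hε0.le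
        _ = 2 * ε * angularPoisson r (s - θ) := by ring
        _ ≤ _ := le_add_of_nonneg_right (by positivity)
    · calc |angularPoissonDeriv r (s - θ)| * ‖Ψ s‖
          ≤ ((1 - r ^ 2) * (2 / m ^ 2)) * B := by
            gcongr
            · exact abs_angularPoissonDeriv_le hr2 hm0 (hm s ⟨hs', h⟩)
            · exact hB s hs'
        _ ≤ _ := le_add_of_nonneg_left (by positivity)
  rw [intervalIntegral.integral_add (Continuous.intervalIntegrable (by fun_prop) _ _)
    intervalIntegrable_const, intervalIntegral.integral_const_mul, integral_angularPoisson hr,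
    intervalIntegral.integral_const, sub_zero, smul_eq_mul] at hbound
  have h4 : 2 * ε * (2 * Real.pi) = η / 2 := by rw [hε]; field_simp; norm_num
  linarith

variable [CompleteSpace E]

/-- **Fatou's theorem** for bounded holomorphic functions on the disc with values in a Hilbert
space. -/
theorem ae_exists_tendsto_circleMap {f : ℂ → E} {C : ℝ}
    (hf : DifferentiableOn ℂ f (Metric.ball 0 1)) (hC : ∀ z ∈ Metric.ball (0 : ℂ) 1, ‖f z‖ ≤ C) :
    ∀ᵐ θ ∂volume.restrict (Set.Ioc 0 (2 * Real.pi)),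
      ∃ y, Tendsto (fun r : ℝ => f (circleMap 0 r θ)) (𝓝[<] 1) (𝓝 y) := by
  have hpi := Real.pi_pos
  have hC0 : 0 ≤ C := (norm_nonneg _).trans (hC 0 (by simp))
  obtain ⟨ρ, G, hρ, hρlim, hGm, hG⟩ := exists_seq_tendsto_boundary hf hC
  have hGC : ∀ᵐ u ∂volume.restrict (Set.Ioc 0 (2 * Real.pi)), ‖G u‖ ≤ C := by
    filter_upwards [hG] with u hu
    exact le_of_tendsto hu.norm (.of_forall fun j => hC _ (circleMap_mem_ball (hρ j) u))
  have hGint : IntervalIntegrable G volume 0 (2 * Real.pi) := by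
    rw [intervalIntegrable_iff_integrableOn_Ioc_of_le (by positivity)]
    exact Integrable.of_bound hGm C hGC
  have hIcc : Set.uIcc 0 (2 * Real.pi) = Set.Icc 0 (2 * Real.pi) := Set.uIcc_of_le (by positivity)
  have hne : ∀ᵐ θ : ℝ, θ ≠ 2 * Real.pi := by simp [ae_iff, measure_singleton]
  -- By Lebesgue differentiation the primitive of G has derivative G θ at almost every θ. The
  -- endpoint 2π is discarded so that the kernel peaks inside the interval.
  filter_upwards [ae_restrict_mem measurableSet_Ioc,
    ae_restrict_of_ae hGint.ae_hasDerivAt_integral, ae_restrict_of_ae hne] with θ hθ hder hθ2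
  rw [hIcc] at hder
  have hθIcc : θ ∈ Set.Icc 0 (2 * Real.pi) := ⟨hθ.1.le, hθ.2⟩
  have hθIoo : θ ∈ Set.Ioo 0 (2 * Real.pi) := ⟨hθ.1, lt_of_le_of_ne hθ.2 hθ2⟩
  replace hder := hder hθIcc θ hθIcc
  set A := G θ with hA
  set Ψ : ℝ → E := fun s => ∫ u in θ..s, (G u - A) with hΨ
  set Ψj : ℕ → ℝ → E := fun j s => ∫ u in θ..s, (f (circleMap 0 (ρ j) u) - A) with hΨj
  set B : ℝ := (C + ‖A‖) * (2 * Real.pi) with hB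
  have hsub : ∀ s ∈ Set.Icc 0 (2 * Real.pi), Set.uIoc θ s ⊆ Set.Ioc 0 (2 * Real.pi) := by
    intro s hs x hx
    rw [Set.mem_uIoc] at hx
    rcases hx with hx | hx
    · exact ⟨hθ.1.trans hx.1, hx.2.trans hs.2⟩
    · exact ⟨hs.1.trans_lt hx.1, hx.2.trans hθ.2⟩
  have hlen : ∀ s ∈ Set.Icc 0 (2 * Real.pi), |s - θ| ≤ 2 * Real.pi := fun s hs =>
    abs_le.2 ⟨by linarith [hs.1, hθ.2], by linarith [hs.2, hθ.1]⟩
  have hΨB : ∀ s ∈ Set.Icc 0 (2 * Real.pi), ‖Ψ s‖ ≤ B := by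
    intro s hs
    have h1 : ‖Ψ s‖ ≤ (C + ‖A‖) * |s - θ| := by
      refine intervalIntegral.norm_integral_le_of_norm_le_const_ae ?_
      filter_upwards [(ae_restrict_iff' measurableSet_Ioc).1 hGC] with u hu hus
      exact (norm_sub_le _ _).trans (add_le_add_left (hu (hsub s hs hus)) _)
    exact h1.trans (mul_le_mul_of_nonneg_left (hlen s hs) (by positivity))
  have hfB : ∀ j u, ‖f (circleMap 0 (ρ j) u) - A‖ ≤ C + ‖A‖ := fun j u =>
    (norm_sub_le _ _).trans (add_le_add_left (hC _ (circleMap_mem_ball (hρ j) u)) _)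
  have hΨjB : ∀ j, ∀ s ∈ Set.Icc 0 (2 * Real.pi), ‖Ψj j s‖ ≤ B := by
    intro j s hs
    have h1 : ‖Ψj j s‖ ≤ (C + ‖A‖) * |s - θ| :=
      intervalIntegral.norm_integral_le_of_norm_le_const fun u _ => hfB j u
    exact h1.trans (mul_le_mul_of_nonneg_left (hlen s hs) (by positivity))
  have hfc : ∀ j, Continuous fun u : ℝ => f (circleMap 0 (ρ j) u) - A := fun j =>
    (continuous_comp_circleMap hf (hρ j)).sub continuous_const
  have hΨlim : ∀ s ∈ Set.Icc 0 (2 * Real.pi), Tendsto (fun j => Ψj j s) atTop (𝓝 (Ψ s)) := by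
    intro s hs
    refine intervalIntegral.tendsto_integral_filter_of_dominated_convergence (fun _ => C + ‖A‖)
      (.of_forall fun j => (hfc j).aestronglyMeasurable)
      (.of_forall fun j => .of_forall fun u _ => hfB j u) intervalIntegrable_const ?_
    filter_upwards [(ae_restrict_iff' measurableSet_Ioc).1 hG] with u hu hus
    exact (hu (hsub s hs hus)).sub_const A
  have hΨ0 : Ψ θ = 0 := intervalIntegral.integral_same
  have hΨder : HasDerivAt Ψ 0 θ := by
    have h1 : HasDerivAt (fun s => (∫ u in θ..s, G u) - (s - θ) • A) (A - (1 : ℝ) • A) θ :=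
      hder.sub (((hasDerivAt_id θ).sub_const θ).smul_const A)
    rw [one_smul, sub_self] at h1
    refine h1.congr_of_eventuallyEq ?_
    filter_upwards [Ioo_mem_nhds hθIoo.1 hθIoo.2] with s hs
    have hint : IntervalIntegrable G volume θ s :=
      hGint.mono_set (by
        rw [hIcc]
        exact Set.uIcc_subset_Icc hθIcc ⟨hs.1.le, hs.2.le⟩)
    simp only [hΨ]
    rw [intervalIntegral.integral_sub hint intervalIntegrable_const,
      intervalIntegral.integral_const]
  have h0mem : (0 : ℝ) ∈ Set.Icc 0 (2 * Real.pi) := ⟨le_rfl, by positivity⟩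
  have h2mem : 2 * Real.pi ∈ Set.Icc 0 (2 * Real.pi) := ⟨by positivity, le_rfl⟩
  -- Let j tend to infinity in the integrated formula for the dilations. Only primitives of the
  -- boundary function occur, so differentiability of the primitive at θ is all that the limit r → 1
  -- requires.
  have hrep : ∀ r ∈ Set.Ioo (0 : ℝ) 1, (2 * Real.pi) • (f (circleMap 0 r θ) - A) =
      angularPoisson r (2 * Real.pi - θ) • Ψ (2 * Real.pi) - angularPoisson r (0 - θ) • Ψ 0 -
        ∫ s in 0..2 * Real.pi, angularPoissonDeriv r (s - θ) • Ψ s := by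
    intro r hr
    have hKc : Continuous fun s => angularPoissonDeriv r (s - θ) :=
      (continuous_angularPoissonDeriv hr).comp (continuous_id.sub continuous_const)
    have hL : Tendsto (fun j => (2 * Real.pi) • (f (ρ j * circleMap 0 r θ) - A)) atTop
        (𝓝 ((2 * Real.pi) • (f (circleMap 0 r θ) - A))) := by
      refine Tendsto.const_smul (Tendsto.sub_const ?_ A) _
      have hcont : ContinuousAt f (circleMap 0 r θ) :=
        (hf.differentiableAt (Metric.isOpen_ball.mem_nhds (circleMap_mem_ball hr θ))).continuousAt
      refine hcont.tendsto.comp ?_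
      have : Tendsto (fun j => (ρ j : ℂ) * circleMap 0 r θ) atTop
          (𝓝 (((1 : ℝ) : ℂ) * circleMap 0 r θ)) :=
        ((Complex.continuous_ofReal.tendsto 1).comp hρlim).mul_const _
      simpa using this
    refine tendsto_nhds_unique hL ?_
    simp only [fun j => integral_angularPoisson_smul_sub hf A hr (hρ j) θ]
    refine (((hΨlim _ h2mem).const_smul _).sub ((hΨlim _ h0mem).const_smul _)).sub ?_
    refine intervalIntegral.tendsto_integral_filter_of_dominated_convergence
      (fun s => |angularPoissonDeriv r (s - θ)| * B) (.of_forall fun j => ?_)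
      (.of_forall fun j => .of_forall fun s hs => ?_)
      (Continuous.intervalIntegrable (by fun_prop) _ _) (.of_forall fun s hs => ?_)
    · refine Continuous.aestronglyMeasurable (hKc.smul ?_)
      exact intervalIntegral.continuous_primitive (fun a b => (hfc j).intervalIntegrable a b) θ
    · rw [Set.uIoc_of_le (by positivity)] at hs
      rw [norm_smul, Real.norm_eq_abs]
      exact mul_le_mul_of_nonneg_left (hΨjB j s ⟨hs.1.le, hs.2⟩) (abs_nonneg _)
    · rw [Set.uIoc_of_le (by positivity)] at hs
      exact (hΨlim s ⟨hs.1.le, hs.2⟩).const_smul _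
  refine ⟨A, ?_⟩
  -- The endpoint terms vanish because the kernel tends to 0 away from its peak; the integral
  -- vanishes because Ψ is o(|s - θ|).
  have hlim := (((tendsto_angularPoisson_zero hθIoo h2mem hθ2.symm).smul_const
    (Ψ (2 * Real.pi))).sub ((tendsto_angularPoisson_zero hθIoo h0mem hθ.1.ne).smul_const (Ψ 0))).sub
      (tendsto_integral_angularPoissonDeriv hθIoo hΨder hΨ0 hΨB)
  simp only [zero_smul, sub_zero] at hlim
  have hlim2 := (hlim.const_smul (2 * Real.pi)⁻¹).add_const A
  rw [smul_zero, zero_add] at hlim2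
  refine hlim2.congr' ?_
  filter_upwards [Ioo_mem_nhdsLT zero_lt_one] with r hr
  rw [← hrep r hr, smul_smul, inv_mul_cancel₀ (by positivity), one_smul,
    sub_add_cancel]

end DiscFatou

/-! ### Fatou's theorem on the polydisc. -/

section TorusFatou

/-- A limit along the rationals of a continuous function is a limit along the reals. -/
lemma tendsto_nhdsLT_of_tendsto_rat {E : Type*} [PseudoMetricSpace E] {g : ℝ → E} {y : E}
    (hg : ContinuousOn g (Set.Ioo 0 1))
    (h : Tendsto (fun q : ℚ => g q) (comap (fun q : ℚ => (q : ℝ)) (𝓝[<] 1)) (𝓝 y)) :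
    Tendsto g (𝓝[<] 1) (𝓝 y) := by
  rw [Metric.tendsto_nhds] at h ⊢
  intro ε hε
  obtain ⟨s, hs, hsub⟩ := mem_comap.1 (h (ε / 2) (by positivity))
  obtain ⟨a, ha, has⟩ := (mem_nhdsLT_iff_exists_Ioo_subset (a := (1 : ℝ))).1 hs
  rw [Set.mem_Iio] at ha
  filter_upwards [Ioo_mem_nhdsLT (max_lt ha zero_lt_one)] with r hr
  have hopen : IsOpen (Set.Ioo (max a 0) (1 : ℝ)) := isOpen_Ioo
  have hcl : r ∈ closure (Set.Ioo (max a 0) 1 ∩ Set.range ((↑) : ℚ → ℝ)) :=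
    Rat.denseRange_cast.open_subset_closure_inter hopen hr
  have h01 : r ∈ Set.Ioo (0 : ℝ) 1 := ⟨(le_max_right a 0).trans_lt hr.1, hr.2⟩
  have hgr : ContinuousAt g r := hg.continuousAt (isOpen_Ioo.mem_nhds h01)
  have hmem : g r ∈ closure (Metric.closedBall y (ε / 2)) := by
    refine hgr.continuousWithinAt.mem_closure hcl ?_
    rintro _ ⟨hq, q, rfl⟩
    exact Metric.ball_subset_closedBall
      (hsub (has ⟨(le_max_left a 0).trans_lt hq.1, hq.2⟩))
  rw [Metric.isClosed_closedBall.closure_eq] at hmem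
  exact (Metric.mem_closedBall.1 hmem).trans_lt (by linarith)

variable {n : ℕ}

instance : (torusMeasure n).IsAddLeftInvariant := by
  unfold torusMeasure; infer_instance

lemma continuous_dilate (r : ℝ) : Continuous (dilate (n := n) r) := by
  unfold dilate
  refine continuous_pi fun i => continuous_const.mul ?_
  exact continuous_subtype_val.comp (AddCircle.continuous_toCircle.comp (continuous_apply i))

variable {E : Type*} [NormedAddCommGroup E] [InnerProductSpace ℂ E]

lemma continuous_comp_dilate {h : (Fin n → ℂ) → E} (hh : AnalyticOnNhd ℂ h (polydisc n)) {r : ℝ}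
    (hr : r ∈ Set.Ioo (0 : ℝ) 1) : Continuous fun t => h (dilate r t) :=
  hh.continuousOn.comp_continuous (continuous_dilate r) (dilate_mem_polydisc hr.1 hr.2)

/-- The diagonal translation of the torus. -/
noncomputable def diagonalAngle (n : ℕ) (θ : ℝ) : UnitAddTorus (Fin n) :=
  fun _ => ((θ / (2 * Real.pi) : ℝ) : UnitAddCircle)

/-- This relates radial limits on the torus to those of slices: rotating all coordinates by θ moves
along the disc through a fixed torus point. -/
lemma dilate_diagonalAngle_add (r θ : ℝ) (t : UnitAddTorus (Fin n)) :
    dilate r (diagonalAngle n θ + t) = circleMap 0 r θ • dilate 1 t := by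
  ext i
  simp only [dilate, diagonalAngle, Pi.add_apply, AddCircle.toCircle_add, Circle.coe_mul,
    Pi.smul_apply, smul_eq_mul, AddCircle.toCircle_apply_mk, Circle.coe_exp, circleMap_zero,
    Complex.ofReal_one, one_mul, mul_assoc]
  congr 3
  push_cast
  have := Complex.ofReal_ne_zero.2 Real.pi_ne_zero
  field_simp

variable [CompleteSpace E]

/-- **Fatou's theorem** for the radial limits of bounded analytic functions on the polydisc with
values in a Hilbert space. -/
theorem ae_exists_tendsto_dilate {h : (Fin n → ℂ) → E} {C : ℝ}
    (hh : AnalyticOnNhd ℂ h (polydisc n)) (hC : ∀ z ∈ polydisc n, ‖h z‖ ≤ C) :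
    ∀ᵐ t ∂torusMeasure n, ∃ y, Tendsto (fun r : ℝ => h (dilate r t)) (𝓝[<] 1) (𝓝 y) := by
  classical
  -- Limits are taken along rational radii so that the set of convergence is measurable; continuity
  -- in r recovers the limit along real radii at the end.
  set l : Filter ℚ := comap (fun q : ℚ => (q : ℝ)) (𝓝[<] 1) with hl
  set g : ℚ → UnitAddTorus (Fin n) → E :=
    fun q t => if (q : ℝ) ∈ Set.Ioo (0 : ℝ) 1 then h (dilate q t) else 0 with hg
  have hgm : ∀ q, StronglyMeasurable (g q) := by
    intro q
    by_cases hq : (q : ℝ) ∈ Set.Ioo (0 : ℝ) 1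
    · simp only [hg, if_pos hq]
      exact (continuous_comp_dilate hh hq).stronglyMeasurable
    · simp only [hg, if_neg hq]
      exact stronglyMeasurable_const
  set S : Set (UnitAddTorus (Fin n)) := {t | ∃ y, Tendsto (g · t) l (𝓝 y)} with hS
  have hSm : MeasurableSet S := StronglyMeasurable.measurableSet_exists_tendsto hgm
  have hev : ∀ t, (fun q => g q t) =ᶠ[l] fun q : ℚ => h (dilate q t) := by
    intro t
    have : ∀ᶠ q : ℚ in l, (q : ℝ) ∈ Set.Ioo (0 : ℝ) 1 :=
      tendsto_comap.eventually (Ioo_mem_nhdsLT zero_lt_one)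
    filter_upwards [this] with q hq using if_pos hq
  have hslice : ∀ t, ∀ᵐ θ ∂volume.restrict (Set.Ioc 0 (2 * Real.pi)),
      diagonalAngle n θ + t ∈ S := by
    intro t
    have hw : ∀ i, ‖dilate 1 t i‖ ≤ 1 := fun i => by
      simp only [dilate, Complex.ofReal_one, one_mul, Circle.norm_coe, le_refl]
    filter_upwards [ae_exists_tendsto_circleMap (differentiableOn_slice hh hw)
      fun l hl => hC _ (smul_mem_polydisc hw hl)] with θ ⟨y, hy⟩
    refine ⟨y, Tendsto.congr' (hev _).symm ?_⟩
    simp only [dilate_diagonalAngle_add]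
    exact hy.comp tendsto_comap
  have hcont : Continuous (diagonalAngle n) :=
    continuous_pi fun _ => (AddCircle.continuous_mk' 1).comp (by fun_prop)
  have hmeas : MeasurableSet {x : ℝ × UnitAddTorus (Fin n) | diagonalAngle n x.1 + x.2 ∈ S} :=
    ((hcont.measurable.comp measurable_fst).add measurable_snd) hSm
  -- By Fubini, for almost every θ the translate of almost every t lies in S. A single such θ
  -- suffices, as the measure is translation invariant.
  have hae := (Measure.ae_ae_comm (μ := torusMeasure n)
    (ν := volume.restrict (Set.Ioc 0 (2 * Real.pi)))
    (p := fun t θ => diagonalAngle n θ + t ∈ S) (measurable_swap hmeas)).1 (.of_forall hslice)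
  have hne : NeBot (ae (volume.restrict (Set.Ioc 0 (2 * Real.pi)))) := by
    rw [ae_restrict_neBot]
    simp [Real.pi_pos]
  obtain ⟨θ, hθ⟩ := hae.exists
  rw [eventually_add_left_iff (torusMeasure n) (diagonalAngle n θ) (p := (· ∈ S))] at hθ
  filter_upwards [hθ] with t ht
  obtain ⟨y, hy⟩ := ht
  refine ⟨y, tendsto_nhdsLT_of_tendsto_rat ?_ (hy.congr' (hev t))⟩
  refine hh.continuousOn.comp ?_ fun r hr => dilate_mem_polydisc hr.1 hr.2 t
  exact Continuous.continuousOn (by unfold dilate; fun_prop)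

end TorusFatou

/-! ### Inner functions give isometric and partially isometric multipliers. -/

section InnerMultiplier

variable {n : ℕ} {F E : Type*} [NormedAddCommGroup F] [InnerProductSpace ℂ F]
  [NormedAddCommGroup E] [InnerProductSpace ℂ E] {Γ : (Fin n → ℂ) → F →L[ℂ] E}

lemma analyticOnNhd_monomial_smul_apply (hΓ : AnalyticOnNhd ℂ Γ (polydisc n)) (j : Fin n → ℕ)
    (x : F) : AnalyticOnNhd ℂ (fun z => (∏ i, z i ^ j i) • Γ z x) (polydisc n) := by
  intro z hz
  refine AnalyticAt.smul ?_ ?_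
  · refine Finset.analyticAt_fun_prod _ fun i _ => AnalyticAt.pow ?_ _
    exact (ContinuousLinearMap.proj (R := ℂ) (φ := fun _ : Fin n => ℂ) i).analyticAt z
  · exact (ContinuousLinearMap.apply ℂ E x).analyticAt (Γ z) |>.comp (hΓ z hz)

lemma norm_monomial_le_one {z : Fin n → ℂ} (hz : z ∈ polydisc n) (j : Fin n → ℕ) :
    ‖∏ i, z i ^ j i‖ ≤ 1 := by
  rw [norm_prod]
  refine Finset.prod_le_one (fun i _ => norm_nonneg _) fun i _ => ?_
  rw [norm_pow]
  exact pow_le_one₀ (norm_nonneg _) (hz i).le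

lemma MemHInfty.exists_bound (hΓ : MemHInfty Γ) :
    ∃ C : ℝ, 0 ≤ C ∧ ∀ (x : F) (j : Fin n → ℕ), ∀ z ∈ polydisc n,
      ‖(∏ i, z i ^ j i) • Γ z x‖ ≤ C * ‖x‖ := by
  obtain ⟨-, C, hC⟩ := hΓ
  have hC0 : 0 ≤ C := (norm_nonneg _).trans (hC 0 fun i => by simp)
  refine ⟨C, hC0, fun x j z hz => ?_⟩
  rw [norm_smul]
  calc ‖∏ i, z i ^ j i‖ * ‖Γ z x‖ ≤ 1 * (C * ‖x‖) := by
        gcongr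
        · exact norm_monomial_le_one hz j
        · exact (Γ z).le_of_opNorm_le (hC z hz) x
    _ = C * ‖x‖ := one_mul _

/-- Polarization. Only the four vectors x ± y and x ± iy enter, so null sets that depend on the
vector do no harm and F need not be separable. -/
lemma IsInner.ae_tendsto_inner (hΓ : IsInner Γ) (x y : F) :
    ∀ᵐ t ∂torusMeasure n,
      Tendsto (fun r : ℝ => ⟪Γ (dilate r t) x, Γ (dilate r t) y⟫_ℂ) (𝓝[<] 1) (𝓝 ⟪x, y⟫_ℂ) := by
  filter_upwards [hΓ.2 (x + y), hΓ.2 (x - y), hΓ.2 (x - Complex.I • y), hΓ.2 (x + Complex.I • y)]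
    with t h1 h2 h3 h4
  have key : ∀ v : F, (∃ w : E, Tendsto (fun r : ℝ => Γ (dilate r t) v) (𝓝[<] 1) (𝓝 w) ∧
      ‖w‖ = ‖v‖) → Tendsto (fun r : ℝ => ((‖Γ (dilate r t) v‖ : ℝ) : ℂ)) (𝓝[<] 1)
        (𝓝 ((‖v‖ : ℝ) : ℂ)) := by
    rintro v ⟨w, hw, hn⟩
    rw [← hn]
    exact (Complex.continuous_ofReal.tendsto _).comp hw.norm
  simp only [inner_eq_sum_norm_sq_div_four (𝕜 := ℂ), RCLike.I_to_complex]
  have := (((key _ h1).pow 2).sub ((key _ h2).pow 2)).add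
    ((((key _ h3).pow 2).sub ((key _ h4).pow 2)).mul_const Complex.I)
  simp only [map_add, map_sub, map_smul] at this ⊢
  exact this.div_const 4

variable [CompleteSpace E]

/-- The element `ζʲ Γ x` of the Hardy space. -/
noncomputable def monomialColumn (hΓ : MemHInfty Γ) (j : Fin n → ℕ) (x : F) : HardySpace n E :=
  (exists_hardySpace_eval_eq (analyticOnNhd_monomial_smul_apply hΓ.1 j x)
    (hΓ.exists_bound.choose_spec.2 x j)).choose

lemma eval_monomialColumn (hΓ : MemHInfty Γ) (j : Fin n → ℕ) (x : F) {z : Fin n → ℂ}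
    (hz : z ∈ polydisc n) : (monomialColumn hΓ j x).eval z = (∏ i, z i ^ j i) • Γ z x :=
  (exists_hardySpace_eval_eq (analyticOnNhd_monomial_smul_apply hΓ.1 j x)
    (hΓ.exists_bound.choose_spec.2 x j)).choose_spec z hz

/-- The inner product is the limit of integrals over tori of radius r. By dominated convergence the
Γ factors contribute the constant ⟪x, y⟫, and the monomials are orthonormal. -/
lemma IsInner.inner_monomialColumn (hΓ : IsInner Γ) (j l : Fin n → ℕ) (x y : F) :
    ⟪monomialColumn hΓ.1 j x, monomialColumn hΓ.1 l y⟫_ℂ = if j = l then ⟪x, y⟫_ℂ else 0 := by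
  have h01 : Set.Ioo (0 : ℝ) 1 ∈ 𝓝[<] (1 : ℝ) := Ioo_mem_nhdsLT zero_lt_one
  obtain ⟨C, hC0, hC⟩ := hΓ.1.exists_bound
  have h1 := HardySpace.tendsto_integral_inner_dilate (monomialColumn hΓ.1 j x)
    (monomialColumn hΓ.1 l y)
  have h2 : Tendsto (fun r : ℝ => ∫ t, ⟪(monomialColumn hΓ.1 j x).eval (dilate r t),
      (monomialColumn hΓ.1 l y).eval (dilate r t)⟫_ℂ ∂torusMeasure n) (𝓝[<] 1)
      (𝓝 (∫ t, conj (torusMonomial j t) * torusMonomial l t * ⟪x, y⟫_ℂ ∂torusMeasure n)) := by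
    refine tendsto_integral_filter_of_dominated_convergence (fun _ => (C * ‖x‖) * (C * ‖y‖))
      ?_ ?_ (integrable_const _) ?_
    · filter_upwards [h01] with r hr
      have hm : ∀ j x, Continuous fun t => (monomialColumn hΓ.1 j x).eval (dilate r t) := by
        intro j x
        simp only [fun t => eval_monomialColumn hΓ.1 j x (dilate_mem_polydisc hr.1 hr.2 t)]
        exact continuous_comp_dilate (analyticOnNhd_monomial_smul_apply hΓ.1.1 j x) hr
      exact ((hm j x).inner (hm l y)).aestronglyMeasurable
    · filter_upwards [h01] with r hr
      refine .of_forall fun t => ?_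
      have hz := dilate_mem_polydisc hr.1 hr.2 t
      rw [eval_monomialColumn _ _ _ hz, eval_monomialColumn _ _ _ hz]
      exact (norm_inner_le_norm _ _).trans
        (mul_le_mul (hC _ _ _ hz) (hC _ _ _ hz) (norm_nonneg _) (by positivity))
    · filter_upwards [hΓ.ae_tendsto_inner x y] with t ht
      have hmon : ∀ k : Fin n → ℕ, Tendsto (fun r : ℝ => ∏ i, dilate r t i ^ k i) (𝓝[<] 1)
          (𝓝 (torusMonomial k t)) := by
        intro k
        have hc : Continuous fun r : ℝ => ∏ i, dilate r t i ^ k i := by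
          unfold dilate; fun_prop
        have := (hc.tendsto 1).mono_left (nhdsWithin_le_nhds (s := Set.Iio 1))
        rwa [prod_dilate_pow, Complex.ofReal_one, one_pow, one_mul] at this
      refine ((((Complex.continuous_conj.tendsto _).comp (hmon j)).mul (hmon l)).mul ht).congr' ?_
      filter_upwards [h01] with r hr
      have hz := dilate_mem_polydisc hr.1 hr.2 t
      rw [eval_monomialColumn _ _ _ hz, eval_monomialColumn _ _ _ hz, inner_smul_left,
        inner_smul_right, Function.comp_apply]
      ring
  rw [tendsto_nhds_unique h1 h2, integral_mul_const, integral_conj_mul_torusMonomial]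
  split_ifs <;> simp

/-- The isometry `x ↦ ζʲ Γ x` for an inner function `Γ`. -/
noncomputable def IsInner.monomialColumnIsometry (hΓ : IsInner Γ) (j : Fin n → ℕ) :
    F →ₗᵢ[ℂ] HardySpace n E where
  toFun := monomialColumn hΓ.1 j
  map_add' x y := HardySpace.eval_ext fun z hz => by
    rw [← HardySpace.evalCLM_apply hz, ← HardySpace.evalCLM_apply hz, map_add,
      HardySpace.evalCLM_apply, HardySpace.evalCLM_apply, HardySpace.evalCLM_apply,
      eval_monomialColumn _ _ _ hz, eval_monomialColumn _ _ _ hz, eval_monomialColumn _ _ _ hz,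
      map_add, smul_add]
  map_smul' c x := HardySpace.eval_ext fun z hz => by
    rw [← HardySpace.evalCLM_apply hz, ← HardySpace.evalCLM_apply hz, map_smul,
      HardySpace.evalCLM_apply, HardySpace.evalCLM_apply, eval_monomialColumn _ _ _ hz,
      eval_monomialColumn _ _ _ hz, map_smul, smul_comm, RingHom.id_apply]
  norm_map' x := by
    have h := hΓ.inner_monomialColumn j j x x
    rw [if_pos rfl, inner_self_eq_norm_sq_to_K, inner_self_eq_norm_sq_to_K] at h
    have h' : ‖monomialColumn hΓ.1 j x‖ ^ 2 = ‖x‖ ^ 2 := by exact_mod_cast h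
    exact (sq_eq_sq₀ (norm_nonneg _) (norm_nonneg _)).1 h'

lemma IsInner.orthogonalFamily (hΓ : IsInner Γ) :
    OrthogonalFamily ℂ (fun _ : Fin n → ℕ => F) hΓ.monomialColumnIsometry := by
  intro j l hjl x y
  exact (hΓ.inner_monomialColumn j l x y).trans (if_neg hjl)

variable [CompleteSpace F]

/-- Multiplication by an inner function is an isometry of Hardy spaces. -/
theorem IsInner.exists_isometric_multiplication (hΓ : IsInner Γ) :
    ∃ M : HardySpace n F →ₗᵢ[ℂ] HardySpace n E,
      IsMultiplicationOperator Γ M.toContinuousLinearMap := by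
  -- The columns zᵏ Γ have orthogonal ranges, so f ↦ ∑ zᵏ Γ fₖ is an isometry; evaluation at z shows
  -- that it multiplies by Γ.
  refine ⟨hΓ.orthogonalFamily.linearIsometry, fun f z hz => ?_⟩
  have h1 := (hΓ.orthogonalFamily.hasSum_linearIsometry f).mapL (HardySpace.evalCLM E hz)
  have h2 := (HardySpace.hasSum_eval f hz).mapL (Γ z)
  have h3 : ∀ k, HardySpace.evalCLM E hz (hΓ.monomialColumnIsometry k (f k)) =
      Γ z ((∏ i, z i ^ k i) • f k) := by
    intro k
    rw [map_smul]
    exact eval_monomialColumn hΓ.1 k (f k) hz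
  simp only [h3] at h1
  exact h1.unique h2

/-- If `Γ` is inner and `V` is an isometry, then `Γ V*` is a partially isometric multiplier. -/
theorem IsInner.exists_isPartialIsometry (hΓ : IsInner Γ) (V : F →ₗᵢ[ℂ] E)
    {Φ : (Fin n → ℂ) → E →L[ℂ] E}
    (hΦ : ∀ z ∈ polydisc n, Φ z = Γ z ∘L ContinuousLinearMap.adjoint V.toContinuousLinearMap) :
    ∃ T : HardySpace n E →L[ℂ] HardySpace n E,
      IsMultiplicationOperator Φ T ∧ IsPartialIsometry T := by
  obtain ⟨M, hM⟩ := hΓ.exists_isometric_multiplication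
  set W : E →L[ℂ] F := ContinuousLinearMap.adjoint V.toContinuousLinearMap with hW
  have hWV : ∀ x, W (V x) = x := by
    intro x
    refine ext_inner_right ℂ fun y => ?_
    rw [hW, ContinuousLinearMap.adjoint_inner_left]
    exact V.inner_map_map x y
  set N : HardySpace n E →L[ℂ] HardySpace n F :=
    lp.mapCLM 2 (fun _ => W) (norm_nonneg W) (fun _ => le_rfl) with hN
  have hNk : ∀ (f : HardySpace n E) k, N f k = W (f k) := fun f k => rfl
  refine ⟨M.toContinuousLinearMap ∘L N, fun f z hz => ?_, fun f hf => ?_⟩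
  · have h1 : (N f).eval z = W (f.eval z) := by
      refine (HardySpace.hasSum_eval (N f) hz).unique ?_
      simpa only [hNk, map_smul] using (HardySpace.hasSum_eval f hz).mapL W
    rw [ContinuousLinearMap.comp_apply, hM _ z hz, h1, hΦ z hz]
    rfl
  -- The kernel contains zᵏ y whenever V* y = 0. Taking y = fₖ - VV* fₖ, orthogonality of f to zᵏ y
  -- gives ‖fₖ‖² = ⟪VV* fₖ, fₖ⟫ = ‖V* fₖ‖².
  · have hk : ∀ k, ‖W (f k)‖ ^ 2 = ‖f k‖ ^ 2 := by
      intro k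
      set y : E := f k - V (W (f k)) with hy
      have hWy : W y = 0 := by rw [hy, map_sub, hWV, sub_self]
      have hker : (lp.single 2 k y : HardySpace n E) ∈
          LinearMap.ker ((M.toContinuousLinearMap ∘L N : HardySpace n E →L[ℂ] HardySpace n E) :
            HardySpace n E →ₗ[ℂ] HardySpace n E) := by
        have h0 : N (lp.single 2 k y) = 0 := by
          ext l
          rw [hNk]
          by_cases hl : l = k
          · subst hl
            rw [lp.single_apply_self, hWy]; rfl
          · rw [lp.single_apply_ne _ _ _ hl, map_zero]; rfl
        rw [LinearMap.mem_ker]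
        change M (N (lp.single 2 k y)) = 0
        rw [h0, map_zero]
      have h1 := Submodule.inner_right_of_mem_orthogonal hker hf
      rw [lp.inner_single_left, hy, inner_sub_left, sub_eq_zero] at h1
      have h2 : ⟪V (W (f k)), f k⟫_ℂ = ⟪W (f k), W (f k)⟫_ℂ := by
        rw [hW, ContinuousLinearMap.adjoint_inner_right]; rfl
      rw [h2, inner_self_eq_norm_sq_to_K, inner_self_eq_norm_sq_to_K] at h1
      exact_mod_cast h1.symm
    have h1 : ‖N f‖ ^ 2 = ‖f‖ ^ 2 := by
      rw [← (HardySpace.hasSum_norm_sq (N f)).tsum_eq, ← (HardySpace.hasSum_norm_sq f).tsum_eq]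
      exact tsum_congr hk
    rw [ContinuousLinearMap.comp_apply]
    exact (M.norm_map _).trans ((sq_eq_sq₀ (norm_nonneg _) (norm_nonneg _)).1 h1)

end InnerMultiplier

/-! ### Partial isometries and the complement of their kernel. -/

section PartialIsometry

lemma IsPartialIsometry.norm_apply_le {H K : Type*} [NormedAddCommGroup H] [InnerProductSpace ℂ H]
    [CompleteSpace H] [NormedAddCommGroup K] [InnerProductSpace ℂ K] {T : H →L[ℂ] K}
    (hT : IsPartialIsometry T) (f : H) : ‖T f‖ ≤ ‖f‖ := by
  set N := LinearMap.ker (T : H →ₗ[ℂ] K) with hN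
  have : CompleteSpace N := T.isClosed_ker.completeSpace_coe
  obtain ⟨m, hm, g, hg, rfl⟩ := N.exists_add_mem_mem_orthogonal f
  have hm' : T m = 0 := hm
  rw [map_add, hm', zero_add, hT g hg]
  have := norm_add_sq_eq_norm_sq_add_norm_sq_of_inner_eq_zero m g (𝕜 := ℂ) (hg m hm)
  nlinarith [norm_nonneg (m + g), norm_nonneg g, mul_self_nonneg ‖m‖]

/-- A vector on which a partial isometry preserves the norm is orthogonal to the kernel. -/
lemma IsPartialIsometry.mem_orthogonal_ker {H K : Type*} [NormedAddCommGroup H]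
    [InnerProductSpace ℂ H] [CompleteSpace H] [NormedAddCommGroup K] [InnerProductSpace ℂ K]
    {T : H →L[ℂ] K} (hT : IsPartialIsometry T) {f : H} (hf : ‖T f‖ = ‖f‖) :
    f ∈ (LinearMap.ker (T : H →ₗ[ℂ] K))ᗮ := by
  set N := LinearMap.ker (T : H →ₗ[ℂ] K) with hN
  have : CompleteSpace N := T.isClosed_ker.completeSpace_coe
  obtain ⟨m, hm, g, hg, rfl⟩ := N.exists_add_mem_mem_orthogonal f
  have hm' : T m = 0 := hm
  rw [map_add, hm', zero_add, hT g hg] at hf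
  have := norm_add_sq_eq_norm_sq_add_norm_sq_of_inner_eq_zero m g (𝕜 := ℂ) (hg m hm)
  rw [← hf] at this
  have hm0 : m = 0 := norm_eq_zero.1 (mul_self_eq_zero.1 (by linarith))
  rwa [hm0, zero_add]

end PartialIsometry

/-! ### Shifts, and how the kernel of the multiplier meets the constants. -/

section Shift

variable {n : ℕ} {E : Type*}

lemma HardySpace.norm_single [NormedAddCommGroup E] (k : Fin n → ℕ) (x : E) :
    ‖(lp.single 2 k x : HardySpace n E)‖ = ‖x‖ :=
  lp.norm_single (E := fun _ : Fin n → ℕ => E) two_pos k x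

variable [NormedAddCommGroup E] [InnerProductSpace ℂ E]

/-- The coefficient embedding `x ↦ zᵏ x`. -/
noncomputable def monomialEmbedding (E : Type*) [NormedAddCommGroup E] [InnerProductSpace ℂ E]
    (k : Fin n → ℕ) : E →ₗᵢ[ℂ] HardySpace n E where
  toLinearMap := lp.lsingle (E := fun _ : Fin n → ℕ => E) 2 k
  norm_map' := HardySpace.norm_single k

@[simp]
lemma monomialEmbedding_apply (k : Fin n → ℕ) (x : E) :
    monomialEmbedding E k x = lp.single 2 k x := rfl

lemma orthogonalFamily_monomialEmbedding (j : Fin n → ℕ) :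
    OrthogonalFamily ℂ (fun _ : Fin n → ℕ => E) fun k => monomialEmbedding E (j + k) := by
  intro k l hkl x y
  have h : j + k ≠ j + l := fun h => hkl (add_left_cancel h)
  rw [monomialEmbedding_apply, monomialEmbedding_apply, lp.inner_single_left,
    lp.single_apply_ne _ _ _ h, inner_zero_right]

variable [CompleteSpace E]

/-- Multiplication by the monomial `zʲ` on the Hardy space. -/
noncomputable def shift (j : Fin n → ℕ) : HardySpace n E →ₗᵢ[ℂ] HardySpace n E :=
  (orthogonalFamily_monomialEmbedding j).linearIsometry

lemma shift_single (j k : Fin n → ℕ) (x : E) :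
    shift j (lp.single 2 k x : HardySpace n E) = lp.single 2 (j + k) x :=
  (orthogonalFamily_monomialEmbedding j).linearIsometry_apply_single x

lemma eval_shift (j : Fin n → ℕ) (f : HardySpace n E) {z : Fin n → ℂ} (hz : z ∈ polydisc n) :
    (shift j f).eval z = (∏ i, z i ^ j i) • f.eval z := by
  have h1 := ((orthogonalFamily_monomialEmbedding j).hasSum_linearIsometry f).mapL
    (HardySpace.evalCLM E hz)
  refine h1.unique ?_
  convert (HardySpace.hasSum_eval f hz).const_smul (∏ i, z i ^ j i) using 2 with k
  rw [monomialEmbedding_apply, HardySpace.evalCLM_apply, HardySpace.eval_single, smul_smul,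
    ← Finset.prod_mul_distrib]
  simp [pow_add]

lemma IsMultiplicationOperator.map_shift {Φ : (Fin n → ℂ) → E →L[ℂ] E}
    {T : HardySpace n E →L[ℂ] HardySpace n E} (hT : IsMultiplicationOperator Φ T) (j : Fin n → ℕ)
    (f : HardySpace n E) : T (shift j f) = shift j (T f) :=
  HardySpace.eval_ext fun z hz => by
    rw [hT _ z hz, eval_shift _ _ hz, eval_shift _ _ hz, hT _ z hz, map_smul]

/-- The kernel of a partially isometric multiplier splits the constants. -/
theorem exists_constant_decomposition {Φ : (Fin n → ℂ) → E →L[ℂ] E}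
    {T : HardySpace n E →L[ℂ] HardySpace n E} (hT : IsMultiplicationOperator Φ T)
    (hiso : IsPartialIsometry T) (x : E) :
    ∃ u v : E, x = u + v ∧
      (lp.single 2 0 u : HardySpace n E) ∈ (LinearMap.ker (T : HardySpace n E →ₗ[ℂ] HardySpace n E))ᗮ ∧
      (lp.single 2 0 v : HardySpace n E) ∈
        LinearMap.ker (T : HardySpace n E →ₗ[ℂ] HardySpace n E) := by
  set N := LinearMap.ker (T : HardySpace n E →ₗ[ℂ] HardySpace n E) with hN
  have : CompleteSpace N := T.isClosed_ker.completeSpace_coe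
  have hker : ∀ j, ∀ m ∈ N, shift j m ∈ N := by
    intro j m hm
    have hm' : T m = 0 := hm
    change T (shift j m) = 0
    rw [hT.map_shift, hm', map_zero]
  -- T commutes with the shift and the shift is isometric, so T still preserves the norm of the
  -- shifted vector, which places it in the complement.
  have horth : ∀ j, ∀ g ∈ Nᗮ, shift j g ∈ Nᗮ := by
    intro j g hg
    refine hiso.mem_orthogonal_ker ?_
    rw [hT.map_shift, (shift j).norm_map, (shift j).norm_map, hiso g hg]
  obtain ⟨m, hm, g, hg, hmg⟩ := N.exists_add_mem_mem_orthogonal (lp.single 2 0 x : HardySpace n E)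
  -- Split y = m' + g', so that zʲ y = zʲ m' + zʲ g'. The first term lies in N and is orthogonal to
  -- g. The second lies in the complement, so pairing it with g is the same as pairing it with x = m
  -- + g, and that is 0 because zʲ g' has no constant term.
  have hg0 : ∀ j, j ≠ 0 → g j = 0 := by
    intro j hj
    refine ext_inner_left ℂ fun y => ?_
    obtain ⟨m', hm', g', hg', hmg'⟩ :=
      N.exists_add_mem_mem_orthogonal (lp.single 2 0 y : HardySpace n E)
    have h1 : (lp.single 2 j y : HardySpace n E) = shift j m' + shift j g' := by
      rw [← map_add, ← hmg', shift_single, add_zero]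
    have h2 : ⟪shift j g', (lp.single 2 0 x : HardySpace n E)⟫_ℂ = 0 := by
      rw [← inner_conj_symm, lp.inner_single_left]
      have h3 : (shift j g' : HardySpace n E) 0 = 0 := by
        refine ext_inner_left ℂ fun w => ?_
        rw [inner_zero_right, ← lp.inner_single_left (𝕜 := ℂ) (G := fun _ : Fin n → ℕ => E)]
        have h4 := ((orthogonalFamily_monomialEmbedding (E := E) j).hasSum_linearIsometry g').mapL
          (innerSL ℂ (lp.single 2 0 w : HardySpace n E))
        refine h4.unique ?_
        convert hasSum_zero using 2 with k
        rw [innerSL_apply_apply, lp.inner_single_left, monomialEmbedding_apply,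
          lp.single_apply_ne, inner_zero_right]
        intro h
        exact hj (by
          ext i
          have := congrFun h i
          simp only [Pi.zero_apply, Pi.add_apply] at this ⊢
          omega)
      rw [h3, inner_zero_right, map_zero]
    rw [inner_zero_right, ← lp.inner_single_left (𝕜 := ℂ) (G := fun _ : Fin n → ℕ => E), h1,
      inner_add_left, hg _ (hker j m' hm'), zero_add]
    rw [hmg, inner_add_right, Submodule.inner_left_of_mem_orthogonal hm (horth j g' hg'),
      zero_add] at h2
    exact h2
  have hgs : g = lp.single 2 0 (g 0) := by
    ext j
    by_cases hj : j = 0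
    · rw [hj, lp.single_apply_self]
    · rw [lp.single_apply_ne _ _ _ hj, hg0 j hj]
  have hms : m = lp.single 2 0 (x - g 0) := by
    rw [lp.single_sub, ← hgs, hmg, add_sub_cancel_right]
  exact ⟨g 0, x - g 0, by abel, hgs ▸ hg, hms ▸ hm⟩

end Shift

/-! ### Recognizing inner functions, and the factorization. -/

section Factorization

variable {n : ℕ} {E F : Type*} [NormedAddCommGroup E] [InnerProductSpace ℂ E] [CompleteSpace E]
  [NormedAddCommGroup F] [InnerProductSpace ℂ F]

/-- A bounded analytic function that is pointwise contractive and isometric as a map from constants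
to the Hardy space is inner. -/
theorem isInner_of_norm_eq {Γ : (Fin n → ℂ) → F →L[ℂ] E} (hΓ : MemHInfty Γ)
    (hc : ∀ z ∈ polydisc n, ∀ x, ‖Γ z x‖ ≤ ‖x‖)
    (hiso : ∀ x : F, ∃ g : HardySpace n E, ‖g‖ = ‖x‖ ∧ ∀ z ∈ polydisc n, g.eval z = Γ z x) :
    IsInner Γ := by
  classical
  refine ⟨hΓ, fun x => ?_⟩
  have h01 : Set.Ioo (0 : ℝ) 1 ∈ 𝓝[<] (1 : ℝ) := Ioo_mem_nhdsLT zero_lt_one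
  have han : AnalyticOnNhd ℂ (fun z => Γ z x) (polydisc n) := by
    simpa using analyticOnNhd_monomial_smul_apply hΓ.1 0 x
  have hae := ae_exists_tendsto_dilate han fun z hz => hc z hz x
  obtain ⟨g, hgx, hg⟩ := hiso x
  -- The default value 0 is used only on the null set where the limit fails to exist.
  set Y : UnitAddTorus (Fin n) → E := fun t =>
    if h : ∃ y, Tendsto (fun r : ℝ => Γ (dilate r t) x) (𝓝[<] 1) (𝓝 y) then h.choose else 0 with hY
  have hYlim : ∀ᵐ t ∂torusMeasure n,
      Tendsto (fun r : ℝ => Γ (dilate r t) x) (𝓝[<] 1) (𝓝 (Y t)) := by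
    filter_upwards [hae] with t ht
    simp only [hY, dif_pos ht]
    exact ht.choose_spec
  have hYle : ∀ᵐ t ∂torusMeasure n, ‖Y t‖ ≤ ‖x‖ := by
    filter_upwards [hYlim] with t ht
    refine le_of_tendsto ht.norm ?_
    filter_upwards [h01] with r hr using hc _ (dilate_mem_polydisc hr.1 hr.2 t) x
  have hmeas : ∀ r ∈ Set.Ioo (0 : ℝ) 1, Continuous fun t => ‖Γ (dilate r t) x‖ ^ 2 := fun r hr =>
    (continuous_comp_dilate han hr).norm.pow 2
  have h1 : Tendsto (fun r : ℝ => ∫ t, ‖Γ (dilate r t) x‖ ^ 2 ∂torusMeasure n) (𝓝[<] 1)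
      (𝓝 (∫ t, ‖Y t‖ ^ 2 ∂torusMeasure n)) := by
    refine tendsto_integral_filter_of_dominated_convergence (fun _ => ‖x‖ ^ 2) ?_ ?_
      (integrable_const _) ?_
    · filter_upwards [h01] with r hr using (hmeas r hr).aestronglyMeasurable
    · filter_upwards [h01] with r hr
      refine .of_forall fun t => ?_
      rw [Real.norm_of_nonneg (by positivity)]
      gcongr
      exact hc _ (dilate_mem_polydisc hr.1 hr.2 t) x
    · filter_upwards [hYlim] with t ht using ht.norm.pow 2
  -- The L² means of g tend both to the integral of ‖Y‖² and to ‖g‖² = ‖x‖². As ‖Y‖ ≤ ‖x‖ almost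
  -- everywhere on a probability space, equality of the integrals forces ‖Y‖ = ‖x‖ almost
  -- everywhere.
  have h2 : ∫ t, ‖Y t‖ ^ 2 ∂torusMeasure n = ‖x‖ ^ 2 := by
    rw [← hgx]
    refine tendsto_nhds_unique h1 ((HardySpace.tendsto_integral_norm_sq_dilate g).congr' ?_)
    filter_upwards [h01] with r hr
    exact integral_congr_ae (.of_forall fun t => by
      simp only [hg _ (dilate_mem_polydisc hr.1 hr.2 t)])
  have hYm : AEStronglyMeasurable (fun t => ‖Y t‖ ^ 2) (torusMeasure n) := by
    obtain ⟨ρ, -, hρ, hρlim⟩ := exists_seq_strictMono_tendsto' (zero_lt_one (α := ℝ))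
    have hρ' : Tendsto ρ atTop (𝓝[<] 1) :=
      tendsto_nhdsWithin_iff.2 ⟨hρlim, .of_forall fun j => (hρ j).2⟩
    refine aestronglyMeasurable_of_tendsto_ae atTop
      (fun j => (hmeas (ρ j) (hρ j)).aestronglyMeasurable) ?_
    filter_upwards [hYlim] with t ht using (ht.comp hρ').norm.pow 2
  have hYint : Integrable (fun t => ‖Y t‖ ^ 2) (torusMeasure n) := by
    refine Integrable.of_bound hYm (‖x‖ ^ 2) ?_
    filter_upwards [hYle] with t ht
    rw [Real.norm_of_nonneg (by positivity)]
    gcongr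
  have h3 : ∫ t, (‖x‖ ^ 2 - ‖Y t‖ ^ 2) ∂torusMeasure n = 0 := by
    rw [integral_sub (integrable_const _) hYint, h2]
    simp
  have h4 := (integral_eq_zero_iff_of_nonneg_ae (by
    filter_upwards [hYle] with t ht
    have : ‖Y t‖ ^ 2 ≤ ‖x‖ ^ 2 := by gcongr
    simpa using this) ((integrable_const _).sub hYint)).1 h3
  filter_upwards [hYlim, h4] with t ht h5
  refine ⟨Y t, ht, (sq_eq_sq₀ (norm_nonneg _) (norm_nonneg _)).1 ?_⟩
  exact (sub_eq_zero.1 h5).symm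

end Factorization

/-- A partially isometric multiplier factors as `Γ V*` with `Γ` inner and `V` the inclusion of a
closed subspace. -/
theorem exists_inner_factorization {n : ℕ} {E : Type u} [NormedAddCommGroup E]
    [InnerProductSpace ℂ E] [CompleteSpace E] {Φ : (Fin n → ℂ) → E →L[ℂ] E} (hΦ : MemHInfty Φ)
    {T : HardySpace n E →L[ℂ] HardySpace n E} (hT : IsMultiplicationOperator Φ T)
    (hiso : IsPartialIsometry T) :
    ∃ (F : Type u) (_ : NormedAddCommGroup F) (_ : InnerProductSpace ℂ F) (_ : CompleteSpace F)
      (Γ : (Fin n → ℂ) → F →L[ℂ] E) (V : F →ₗᵢ[ℂ] E),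
      IsInner Γ ∧
        ∀ z ∈ polydisc n, Φ z = Γ z ∘L ContinuousLinearMap.adjoint V.toContinuousLinearMap := by
  set N := LinearMap.ker (T : HardySpace n E →ₗ[ℂ] HardySpace n E) with hN
  have hconst : ∀ (x : E) (z), z ∈ polydisc n →
      (T (lp.single 2 0 x : HardySpace n E)).eval z = Φ z x := by
    intro x z hz
    rw [hT _ z hz, HardySpace.eval_single]
    simp
  set F : Submodule ℂ E := Nᗮ.comap (monomialEmbedding E (0 : Fin n → ℕ)).toLinearMap with hF
  have hFclosed : IsClosed (F : Set E) :=
    N.isClosed_orthogonal.preimage (monomialEmbedding E (0 : Fin n → ℕ)).continuous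
  have : CompleteSpace F := hFclosed.completeSpace_coe
  have hmemF : ∀ x, x ∈ F ↔ (lp.single 2 0 x : HardySpace n E) ∈ Nᗮ := fun x => Iff.rfl
  -- In the decomposition y = u + v, the part u lies in F and is orthogonal to both v and y, so u =
  -- 0 and the constant y is in the kernel.
  have hFperp : ∀ y ∈ Fᗮ, ∀ z ∈ polydisc n, Φ z y = 0 := by
    intro y hy z hz
    obtain ⟨u, v, rfl, hu, hv⟩ := exists_constant_decomposition hT hiso y
    have huv : ⟪u, v⟫_ℂ = 0 := by
      have := Submodule.inner_left_of_mem_orthogonal hv hu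
      rwa [lp.inner_single_left, lp.single_apply_self] at this
    have hu0 : ⟪u, u + v⟫_ℂ = 0 := hy u ((hmemF u).2 hu)
    rw [inner_add_right, huv, add_zero, inner_self_eq_zero] at hu0
    have hv' : T (lp.single 2 0 v : HardySpace n E) = 0 := hv
    rw [hu0, zero_add, ← hconst v z hz, hv']
    simp [HardySpace.eval]
  refine ⟨F, inferInstance, inferInstance, inferInstance, fun z => Φ z ∘L F.subtypeL,
    F.subtypeₗᵢ, ?_, ?_⟩
  · refine isInner_of_norm_eq ⟨?_, ?_⟩ ?_ ?_
    · intro z hz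
      exact ((ContinuousLinearMap.compL ℂ F E E).flip F.subtypeL).analyticAt (Φ z) |>.comp
        (hΦ.1 z hz)
    · obtain ⟨C, hC⟩ := hΦ.2
      have hC0 : 0 ≤ C := (norm_nonneg _).trans (hC 0 fun i => by simp)
      refine ⟨C, fun z hz => ContinuousLinearMap.opNorm_le_bound _ hC0 fun x => ?_⟩
      exact (Φ z).le_of_opNorm_le (hC z hz) x
    · intro z hz x
      exact HardySpace.norm_le_one_of_contractive hT hiso.norm_apply_le hz (x : E)
    · intro x
      refine ⟨T (lp.single 2 0 (x : E)), ?_, fun z hz => hconst x z hz⟩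
      rw [hiso _ ((hmemF _).1 x.2)]
      exact HardySpace.norm_single _ _
  · intro z hz
    ext x
    -- V* is the projection onto F, so the difference of the two sides is Φ(z) applied to a vector
    -- orthogonal to F.
    have hadj : ContinuousLinearMap.adjoint F.subtypeₗᵢ.toContinuousLinearMap =
        F.orthogonalProjectionOnto := F.adjoint_subtypeL
    rw [hadj, ContinuousLinearMap.comp_apply, ContinuousLinearMap.comp_apply,
      Submodule.subtypeL_apply, ← sub_eq_zero, ← map_sub]
    exact hFperp _ (F.sub_starProjection_mem_orthogonal x) z hz

end PolydiscHardy

theorem theorem4p4 (n : ℕ) (E : Type u) [NormedAddCommGroup E] [InnerProductSpace ℂ E]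
    [CompleteSpace E] (Φ : (Fin n → ℂ) → E →L[ℂ] E) (hΦ : MemHInfty Φ) :
    (∃ T : HardySpace n E →L[ℂ] HardySpace n E,
        IsMultiplicationOperator Φ T ∧ IsPartialIsometry T) ↔
      ∃ (F : Type u) (_ : NormedAddCommGroup F) (_ : InnerProductSpace ℂ F) (_ : CompleteSpace F)
        (Γ : (Fin n → ℂ) → F →L[ℂ] E) (V : F →ₗᵢ[ℂ] E),
        IsInner Γ ∧
          ∀ z ∈ polydisc n, Φ z = Γ z ∘L ContinuousLinearMap.adjoint V.toContinuousLinearMap := by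
  constructor
  · rintro ⟨T, hT, hiso⟩
    exact exists_inner_factorization hΦ hT hiso
  · rintro ⟨F, _, _, _, Γ, V, hΓ, h⟩
    exact hΓ.exists_isPartialIsometry V h
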